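/- All graphs are finite, simple and undirected. An edge of a connected graph $G$ is a proper bridge if deleting it disconnects $G$ and neither of its ends has degree $1$. An elimination forest of $G$ is a rooted forest $F$ with $V(F)=V(G)$ such that the ends of every edge of $G$ lie on a common root-to-leaf path of $F$; the treedepth $\mathrm{td}(G)$ is the minimum height of an elimination forest of $G$, where the height is the maximum number of vertices on a root-to-leaf path. For an integer $c\ge 0$, an induced subgraph $G'=G[C]$, where $\emptyset\neq C\subseteq V(G)$, is a $T$-type subgraph of $G$ with treedepth bound $c$ if $\mathrm{td}(G')\le c$ and there is a set $S\subseteq V(G)\setminus C$ with $|S|\le 2$ such that $S$ is the set of all vertices outside $C$ that have a neighbour in $C$, and every $v\in S$ has at least two neighbours in $C\cup S$. For $k\ge 1$, $S_{1,k,k,k}$ is the tree obtained from the star $K_{1,4}$ by subdividing three of its edges $k-1$ times each. Theorem. Let $k\ge 1$ be an integer and let $c=16(2k-1)(k-1)$. Let $G$ be a connected graph that has no proper bridge, has a vertex of degree at least $4$, satisfies $$\mathrm{td}(G)\ \ge\ 8\left(7k^3+15k^2-\tfrac{4k}{9}+3\right)^2+6,$$ and has no $T$-type subgraph with treedepth bound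 $c$. Then $G$ contains $S_{1,k,k,k}$ as a (not necessarily induced) subgraph. -/

import Mathlib

namespace SimpleGraph

variable {V : Type*}

/-- An elimination forest of `G`: a rooted forest with vertex set `V`, given by its ancestor
relation (`anc u v` says that `u` lies on the path from the root of the tree of `v` to `v`), such
that the ends of every edge of `G` lie on a common root-to-leaf path. On a finite vertex set, the
ancestor relations of rooted forests are exactly the partial orders in which the elements below
any given element form a chain. -/
structure EliminationForest (G : SimpleGraph V) where
  /-- `anc u v`: the vertex `u` is equal to `v` or an ancestor of `v` -/
  anc : V → V → Prop
  anc_refl : ∀ v, anc v v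
  anc_trans : ∀ u v w, anc u v → anc v w → anc u w
  anc_antisymm : ∀ u v, anc u v → anc v u → u = v
  anc_total_of_anc : ∀ u w v, anc u v → anc w v → anc u w ∨ anc w u
  anc_or_anc_of_adj : ∀ u v, G.Adj u v → anc u v ∨ anc v u

/-- The forest has height at most `d`: every path starting at a root and going down has at most
`d` vertices. (The path from the root to `v` consists of the vertices `u` with `anc u v`.) -/
def EliminationForest.HeightLE {G : SimpleGraph V} (T : G.EliminationForest) (d : ℕ) : Prop :=
  ∀ v, {u | T.anc u v}.ncard ≤ d

/-- The treedepth of a finite graph: the minimum height of an elimination forest, the height being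
counted in vertices (so a one-vertex graph has treedepth `1`). -/
noncomputable def treedepth [Finite V] (G : SimpleGraph V) : ℕ :=
  sInf {d | ∃ T : G.EliminationForest, T.HeightLE d}

/-- The minimum in the definition of treedepth is attained. -/
theorem exists_heightLE_treedepth [Finite V] (G : SimpleGraph V) :
    ∃ T : G.EliminationForest, T.HeightLE G.treedepth := by
  have hne : {d | ∃ T : G.EliminationForest, T.HeightLE d}.Nonempty := by
    obtain ⟨n, ⟨e⟩⟩ := Finite.exists_equiv_fin V
    refine ⟨Nat.card V,
      ⟨fun u v => e u ≤ e v, fun _ => le_rfl, fun _ _ _ => le_trans,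
        fun _ _ h h' => e.injective (le_antisymm h h'),
        fun _ _ _ _ _ => le_total _ _, fun _ _ _ => le_total _ _⟩, fun v => ?_⟩
    exact Set.ncard_le_card _
  exact Nat.sInf_mem hne

/-- `uv` is a proper bridge of `G`: an edge that is a bridge and neither end of which has
degree `1`. -/
def IsProperBridge [Fintype V] (G : SimpleGraph V) [DecidableRel G.Adj] (u v : V) : Prop :=
  G.Adj u v ∧ G.IsBridge s(u, v) ∧ G.degree u ≠ 1 ∧ G.degree v ≠ 1

/-- The (outer) neighbourhood `N(C) \ C` of a set `C` of vertices. -/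
def outerNeighbors (G : SimpleGraph V) (C : Set V) : Set V :=
  {v | v ∉ C ∧ ∃ u ∈ C, G.Adj u v}

/-- The induced subgraph `G[C]` (with `C` non-empty) is a `T`-type subgraph of `G` with treedepth
bound `c`: it has treedepth at most `c` and there is a witness set `S` of at most two vertices
outside `C` with `N(C) \ C = S`, each of which has at least two neighbours in `C ∪ S`. -/
def IsTType [Finite V] (G : SimpleGraph V) (c : ℕ) (C : Set V) : Prop :=
  C.Nonempty ∧ (G.induce C).treedepth ≤ c ∧
    ∃ S : Set V, S ⊆ Cᶜ ∧ S.ncard ≤ 2 ∧ G.outerNeighbors C = S ∧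
      ∀ v ∈ S, 2 ≤ (G.neighborSet v ∩ (C ∪ S)).ncard

/-- The subdivided star with one branch of length `a i` for every `i`: the centre is `none`, and
`some ⟨i, j⟩` is the vertex at distance `j + 1` from the centre on the branch `i`. -/
def subdividedStar {n : ℕ} (a : Fin n → ℕ) : SimpleGraph (Option (Σ i : Fin n, Fin (a i))) :=
  SimpleGraph.fromRel fun x y =>
    (∃ (i : Fin n) (j : Fin (a i)), x = none ∧ y = some ⟨i, j⟩ ∧ (j : ℕ) = 0) ∨
    (∃ (i : Fin n) (j j' : Fin (a i)), x = some ⟨i, j⟩ ∧ y = some ⟨i, j'⟩ ∧ (j' : ℕ) = j + 1)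

end SimpleGraph

/-! The proof looks for legs: long paths that share only their start `w`. Three legs of length at
least `2k-1` at a vertex of degree at least 4 give the star. A further neighbour of `w` is either
off the legs or on one of them, and that leg can then be cut short or rerouted while keeping length
`k` and leaving some neighbour of `w` free (`PathTo.exists_shortcut`,
`HasFan.subdividedStar_isContained`).

Large treedepth yields one long path from any vertex, by depth-first search. The engine is a
Menger-type dichotomy, `IsTracks.exists_frontier`: `r` very long legs either lead to `r + 1` long
ones or reveal an obstruction. It is an augmenting-path argument. Level by level one records how far
along each track the bridges from the part reached so far can land. Each newly reached vertex ends
an additional leg, disjoint from legs that end on all the tracks, and each level raises a bounded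
total of leg weights by one. Without a fan of `r + 1` legs the levels therefore stall, and a bounded
initial part of the tracks, with everything attached to it, meets the rest only in one frontier
vertex per track.

For `r = 1` the obstruction is a cut vertex; for `r = 2` it is a set of small treedepth with at most
two outer neighbours. If no vertex splits `G` into components of which two are nontrivial, a vertex
of degree at least 4 has two very long legs, hence either a third one or a `T`-type subgraph
(`exists_isTType_of_frontier`). If `x` splits `G`, the hypotheses give `x` two neighbours in each
nontrivial component, and each such component large treedepth. By induction on the size of one of
them, either it carries two legs at `x`, with the third leg and the extra edge found in another
component, or it contains a cut vertex splitting off something smaller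
(`IsSplit.subdividedStar_isContained`). -/

namespace SimpleGraph

/-! ### Walks inside a set, and paths with their vertex sets -/

/-- `v` can be reached from `u` by a walk inside `A`. -/
inductive ReachIn {V : Type*} (G : SimpleGraph V) (A : Set V) (u : V) : V → Prop
  | refl : u ∈ A → ReachIn G A u u
  | tail {v x : V} : ReachIn G A u v → G.Adj v x → x ∈ A → ReachIn G A u x

/-- There is a path of length `l` from `w` to `v` with vertex set `W`. -/
inductive PathTo {V : Type*} (G : SimpleGraph V) (w : V) : V → Set V → ℕ → Prop
  | nil : PathTo G w w {w} 0
  | snoc {v x : V} {W : Set V} {l : ℕ} :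
      PathTo G w v W l → G.Adj v x → x ∉ W → PathTo G w x (insert x W) (l + 1)

section Basic

variable {V : Type*} {G F : SimpleGraph V} {A B D W : Set V} {u v w x y z : V} {l m : ℕ}

namespace ReachIn

theorem mem_left (h : ReachIn G A u v) : u ∈ A := by
  induction h with
  | refl h => exact h
  | tail _ _ _ ih => exact ih

theorem mem_right (h : ReachIn G A u v) : v ∈ A := by
  cases h <;> assumption

theorem trans (h : ReachIn G A u v) (h' : ReachIn G A v x) : ReachIn G A u x := by
  induction h' with
  | refl _ => exact h
  | tail _ ha hx ih => exact ih.tail ha hx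

theorem single (hu : u ∈ A) (h : G.Adj u v) (hv : v ∈ A) : ReachIn G A u v :=
  (ReachIn.refl hu).tail h hv

theorem symm (h : ReachIn G A u v) : ReachIn G A v u := by
  induction h with
  | refl h => exact .refl h
  | tail h ha hx ih => exact (single hx ha.symm h.mem_right).trans ih

theorem mono (h : ReachIn G A u v) (hAB : A ⊆ B) : ReachIn G B u v := by
  induction h with
  | refl h => exact .refl (hAB h)
  | tail _ ha hx ih => exact ih.tail ha (hAB hx)

/-- A walk inside `A` from `u` stays in any set `B ∋ u` that it cannot leave. -/
theorem of_closed (h : ReachIn G A u v) (hu : u ∈ B)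
    (hB : ∀ a ∈ B, ∀ b ∈ A, ReachIn G A u b → G.Adj a b → b ∈ B) : ReachIn G (A ∩ B) u v := by
  induction h with
  | refl h => exact .refl ⟨h, hu⟩
  | tail h ha hx ih => exact ih.tail ha ⟨hx, hB _ ih.mem_right.2 _ hx (h.tail ha hx) ha⟩

theorem within_component (h : ReachIn G A u v) : ReachIn G {z | ReachIn G A u z} u v := by
  have := h.of_closed (B := {z | ReachIn G A u z}) (.refl h.mem_left) (fun _ _ _ _ hb _ => hb)
  exact this.mono Set.inter_subset_right

theorem exists_adj_of_ne (h : ReachIn G A u v) (hne : u ≠ v) : ∃ x ∈ A, G.Adj v x := by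
  cases h with
  | refl h => exact absurd rfl hne
  | tail h ha hx => exact ⟨_, h.mem_right, ha.symm⟩

/-- The last step of a walk from outside of `B` into `B`. -/
theorem exists_step (h : ReachIn G A u v) (hu : u ∉ B) (hv : v ∈ B) :
    ∃ a b, ReachIn G (A \ B) u a ∧ b ∈ A ∧ b ∈ B ∧ G.Adj a b := by
  by_contra hcon
  push Not at hcon
  have : ∀ {t}, ReachIn G A u t → ReachIn G (A \ B) u t := by
    intro t ht
    induction ht with
    | refl h => exact .refl ⟨h, hu⟩
    | tail h ha hx ih =>
      refine ih.tail ha ⟨hx, fun hxB => hcon _ _ ih hx hxB ha⟩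
  exact (this h).mem_right.2 hv

end ReachIn

theorem Walk.reachIn (p : G.Walk u v) (hp : ∀ z ∈ p.support, z ∈ A) : ReachIn G A u v := by
  induction p with
  | nil => exact .refl (hp _ (by simp))
  | cons h p ih =>
    refine (ReachIn.single (hp _ (by simp)) h (hp _ (by simp))).trans (ih fun z hz => hp z ?_)
    simp [hz]

theorem Connected.reachIn_univ (h : G.Connected) (u v : V) : ReachIn G Set.univ u v := by
  obtain ⟨p⟩ := h.preconnected u v
  exact p.reachIn fun _ _ => trivial

namespace PathTo

theorem mem_start (h : PathTo G w v W l) : w ∈ W := by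
  induction h with
  | nil => rfl
  | snoc _ _ _ ih => exact Or.inr ih

theorem mem_end (h : PathTo G w v W l) : v ∈ W := by
  cases h with
  | nil => rfl
  | snoc => exact Or.inl rfl

theorem mono_graph (h : PathTo F w v W l) (hFG : F ≤ G) : PathTo G w v W l := by
  induction h with
  | nil => exact .nil
  | snoc _ ha hx ih => exact .snoc ih (hFG ha) hx

theorem truncate (h : PathTo G w v W l) (hz : z ∈ W) :
    ∃ W' ⊆ W, ∃ l' ≤ l, PathTo G w z W' l' := by
  induction h with
  | nil => obtain rfl := hz; exact ⟨_, subset_rfl, 0, le_rfl, .nil⟩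
  | @snoc v x W l h ha hx ih =>
    rcases hz with rfl | hz
    · exact ⟨_, subset_rfl, _, le_rfl, h.snoc ha hx⟩
    · obtain ⟨W', hW', l', hl', h'⟩ := ih hz
      exact ⟨W', hW'.trans (Set.subset_insert _ _), l', by omega, h'⟩

theorem append (h : PathTo G w v W l) (ha : G.Adj v x) (h' : PathTo G x y D m)
    (hd : Disjoint W D) : PathTo G w y (W ∪ D) (l + 1 + m) := by
  induction h' with
  | nil =>
    have hx : x ∉ W := fun hx => Set.disjoint_left.1 hd hx rfl
    have := h.snoc ha hx
    rwa [← Set.union_singleton] at this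
  | @snoc v' x' D m h' ha' hx' ih =>
    have hd' : Disjoint W D := hd.mono_right (Set.subset_insert _ _)
    have := (ih hd').snoc ha' (x := x') (by
      rintro (h1 | h1)
      · exact Set.disjoint_left.1 hd h1 (Or.inl rfl)
      · exact hx' h1)
    rwa [← Set.union_insert] at this

theorem exists_fun (h : PathTo G w v W l) :
    ∃ f : ℕ → V, f 0 = w ∧ f l = v ∧ (∀ i < l, G.Adj (f i) (f (i + 1))) ∧
      (∀ i ≤ l, f i ∈ W) ∧ (∀ z ∈ W, ∃ i ≤ l, f i = z) ∧
      (∀ i ≤ l, ∀ j ≤ l, f i = f j → i = j) := by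
  induction h with
  | nil =>
    refine ⟨fun _ => w, rfl, rfl, by simp, by simp, ?_, by intros; omega⟩
    rintro z rfl
    exact ⟨0, le_rfl, rfl⟩
  | @snoc v x W l h ha hx ih =>
    obtain ⟨f, h0, hl, hadj, hmem, hsurj, hinj⟩ := ih
    have hne : ∀ i ≤ l, f i ≠ x := fun i hi e => hx (e ▸ hmem i hi)
    refine ⟨fun i => if i ≤ l then f i else x, by simpa using h0, by simp, ?_, ?_, ?_, ?_⟩
    · intro i hi
      rcases Nat.lt_or_ge i l with h1 | h1
      · simpa [h1.le, Nat.succ_le_of_lt h1] using hadj i h1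
      · obtain rfl : i = l := by omega
        simpa [hl] using ha
    · intro i hi
      dsimp only
      split_ifs with h1
      · exact Or.inr (hmem i h1)
      · exact Or.inl rfl
    · rintro z (rfl | hz)
      · exact ⟨l + 1, le_rfl, by simp⟩
      · obtain ⟨i, hi, rfl⟩ := hsurj z hz
        exact ⟨i, by omega, by simp [hi]⟩
    · intro i hi j hj
      dsimp only
      split_ifs with h1 h2 h2
      · exact hinj i h1 j h2
      · intro e; exact absurd e (hne i h1)
      · intro e; exact absurd e.symm (hne j h2)
      · intros; omega

theorem of_fun (f : ℕ → V) (hadj : ∀ i < l, G.Adj (f i) (f (i + 1)))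
    (hinj : ∀ i ≤ l, ∀ j ≤ l, f i = f j → i = j) :
    PathTo G (f 0) (f l) (f '' Set.Iic l) l := by
  induction l with
  | zero =>
    have : f '' Set.Iic 0 = {f 0} := by ext; simp [eq_comm]
    rw [this]
    exact .nil
  | succ l ih =>
    have h := ih (fun i hi => hadj i (by omega)) (fun i hi j hj => hinj i (by omega) j (by omega))
    have h' := h.snoc (hadj l (by omega)) (by
      rintro ⟨i, hi, e⟩
      have := hinj i (Nat.le_succ_of_le hi) (l + 1) le_rfl e
      simp at hi
      omega)
    have e : f '' Set.Iic (l + 1) = insert (f (l + 1)) (f '' Set.Iic l) := by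
      rw [← Set.image_insert_eq]
      congr 1
      ext i
      simp
      omega
    rwa [e]

end PathTo

theorem ReachIn.exists_pathTo (h : ReachIn G A u v) : ∃ W ⊆ A, ∃ l, PathTo G u v W l := by
  induction h with
  | refl h => exact ⟨{u}, by simpa using h, 0, .nil⟩
  | @tail v x h ha hx ih =>
    obtain ⟨W, hW, l, hp⟩ := ih
    by_cases hxW : x ∈ W
    · obtain ⟨W', hW', l', -, h'⟩ := hp.truncate hxW
      exact ⟨W', hW'.trans hW, l', h'⟩
    · exact ⟨_, Set.insert_subset hx hW, _, hp.snoc ha hxW⟩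

end Basic

/-! ### Vertex rankings as upper bounds for treedepth -/

section Ranking

variable {V : Type*} {G : SimpleGraph V} {A B : Set V}

/-- Two vertices of `A` with the same rank are separated in `A` by vertices of higher rank. -/
def IsRanking (G : SimpleGraph V) (A : Set V) (f : V → ℕ) : Prop :=
  ∀ u ∈ A, ∀ v ∈ A, u ≠ v → f u = f v → ¬ ReachIn G {z | z ∈ A ∧ f z ≤ f u} u v

theorem IsRanking.mono {f : V → ℕ} (h : IsRanking G A f) (hBA : B ⊆ A) : IsRanking G B f :=
  fun u hu v hv hne he hr => h u (hBA hu) v (hBA hv) hne he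
    (hr.mono fun _ hz => ⟨hBA hz.1, hz.2⟩)

theorem ReachIn.of_induce {P : Set V} {u v : A} (h : ReachIn (G.induce A) {z | z.1 ∈ P} u v) :
    ReachIn G (A ∩ P) u.1 v.1 := by
  induction h with
  | refl h => exact .refl ⟨u.2, h⟩
  | @tail v x _ ha hx ih => exact ih.tail ha ⟨x.2, hx⟩

/-- Call `u` an ancestor of `v` if `v` can be reached from `u` through vertices ranked no higher
than `u`. Two ancestors of one vertex with equal rank would be joined through vertices of at most
that rank, so ranks along a root-to-leaf path are distinct. -/
theorem IsRanking.treedepth_induce_le [Finite V] {f : V → ℕ} {d : ℕ} (h : IsRanking G A f)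
    (hd : ∀ z ∈ A, f z < d) : (G.induce A).treedepth ≤ d := by
  have key : ∀ u v : A, u ≠ v → f u = f v →
      ¬ ReachIn (G.induce A) {z | f z ≤ f u} u v := by
    intro u v hne he hr
    refine h u u.2 v v.2 (fun e => hne (Subtype.ext e)) he ?_
    exact (ReachIn.of_induce (P := {z | f z ≤ f u}) hr).mono fun z hz => ⟨hz.1, hz.2⟩
  have hmono : ∀ {m n : ℕ}, m ≤ n → {z : A | f z ≤ m} ⊆ {z : A | f z ≤ n} :=
    fun hmn z hz => le_trans hz hmn
  refine Nat.sInf_le ⟨{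
    anc := fun u v => ReachIn (G.induce A) {z | f z ≤ f u} u v
    anc_refl := fun v => .refl (le_refl (f v))
    anc_trans := fun u v w huv hvw => huv.trans (hvw.mono (hmono huv.mem_right))
    anc_antisymm := fun u v huv hvu => by
      by_contra hne
      exact key u v hne (le_antisymm hvu.mem_right huv.mem_right) huv
    anc_total_of_anc := fun u w v huv hwv => by
      rcases le_total (f u) (f w) with hle | hle
      · exact Or.inr (hwv.trans (huv.mono (hmono hle)).symm)
      · exact Or.inl (huv.trans (hwv.mono (hmono hle)).symm)
    anc_or_anc_of_adj := fun u v hadj => by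
      rcases le_total (f u) (f v) with hle | hle
      · exact Or.inr (ReachIn.single (le_refl (f v)) hadj.symm hle)
      · exact Or.inl (ReachIn.single (le_refl (f u)) hadj hle) }, fun v => ?_⟩
  rw [← Set.InjOn.ncard_image (f := fun z : A => f z)]
  · refine (Set.ncard_le_ncard (t := Set.Iio d) ?_ (Set.finite_Iio d)).trans (by simp)
    rintro _ ⟨z, -, rfl⟩
    exact hd z z.2
  · intro a ha b hb he
    by_contra hne
    have he' : f a = f b := he
    refine key a b hne he' (ReachIn.trans ha (ReachIn.symm ?_))
    have hb' : ReachIn (G.induce A) {z | f z ≤ f b} b v := hb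
    rwa [← he'] at hb'

/-- Rankings of the components of `G[A]` combine to a ranking of `G[A]`. -/
theorem exists_isRanking_of_components {d : ℕ}
    (h : ∀ z ∈ A, ∃ f, IsRanking G {y | ReachIn G A z y} f ∧ ∀ y, ReachIn G A z y → f y < d) :
    ∃ f, IsRanking G A f ∧ ∀ z ∈ A, f z < d := by
  classical
  let K : V → Set V := fun z => {y | ReachIn G A z y}
  have hK : ∀ z y, ReachIn G A z y → K z = K y := fun z y hzy =>
    Set.ext fun t => ⟨fun ht => hzy.symm.trans ht, fun ht => hzy.trans ht⟩
  -- The ranking is chosen from the component as a set, so all vertices of a component use the same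
  -- one.
  let Φ : Set V → V → ℕ := fun S =>
    if hS : ∃ f, IsRanking G S f ∧ ∀ y ∈ S, f y < d then hS.choose else fun _ => 0
  have hΦ : ∀ z ∈ A, IsRanking G (K z) (Φ (K z)) ∧ ∀ y ∈ K z, Φ (K z) y < d := by
    intro z hz
    have hS : ∃ f, IsRanking G (K z) f ∧ ∀ y ∈ K z, f y < d := h z hz
    simp only [Φ, dif_pos hS]
    exact hS.choose_spec
  refine ⟨fun z => Φ (K z) z, ?_, fun z hz => (hΦ z hz).2 z (.refl hz)⟩
  intro u hu v hv hne he hr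
  have huv : ReachIn G A u v := hr.mono fun _ hz => hz.1
  dsimp only at he hr
  rw [← hK u v huv] at he
  refine (hΦ u hu).1 u (.refl hu) v huv hne he ?_
  have := hr.of_closed (B := K u) (.refl hu)
    (fun a _ b hb hub hab => hub.mono fun _ hz => hz.1)
  refine this.mono ?_
  rintro z ⟨⟨hzA, hz⟩, hzK⟩
  refine ⟨hzK, ?_⟩
  rwa [← hK u z hzK] at hz

/-- Adding a finite set of vertices to a ranking. -/
theorem exists_isRanking_of_diff {I : Set V} (hI : I.Finite) {d : ℕ} {f : V → ℕ}
    (hf : IsRanking G (A \ I) f) (hd : ∀ z ∈ A \ I, f z < d) :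
    ∃ f, IsRanking G A f ∧ ∀ z ∈ A, f z < d + I.ncard := by
  classical
  have := hI.to_subtype
  obtain ⟨e⟩ : Nonempty (I ≃ Fin (Nat.card I)) := ⟨Finite.equivFin I⟩
  let g : V → ℕ := fun z => if hz : z ∈ I then d + e ⟨z, hz⟩ else f z
  have hg1 : ∀ z (hz : z ∈ I), g z = d + e ⟨z, hz⟩ := fun z hz => dif_pos hz
  have hg2 : ∀ z, z ∉ I → g z = f z := fun z hz => dif_neg hz
  refine ⟨g, ?_, ?_⟩
  · intro u hu v hv hne he hr
    by_cases huI : u ∈ I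
    · by_cases hvI : v ∈ I
      · rw [hg1 u huI, hg1 v hvI] at he
        have : e ⟨u, huI⟩ = e ⟨v, hvI⟩ := Fin.ext (by omega)
        exact hne (congrArg Subtype.val (e.injective this))
      · have := hd v ⟨hv, hvI⟩
        rw [hg1 u huI, hg2 v hvI] at he
        omega
    · have h1 := hd u ⟨hu, huI⟩
      have hlow : ∀ z ∈ A, g z ≤ g u → z ∉ I := by
        intro z _ hz hzI
        rw [hg1 z hzI, hg2 u huI] at hz
        omega
      have hvI := hlow v hv he.ge
      refine hf u ⟨hu, huI⟩ v ⟨hv, hvI⟩ hne (by rwa [hg2 u huI, hg2 v hvI] at he) ?_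
      refine hr.mono ?_
      rintro z ⟨hzA, hz⟩
      have hzI := hlow z hzA hz
      rw [hg2 z hzI, hg2 u huI] at hz
      exact ⟨⟨hzA, hzI⟩, hz⟩
  · intro z hz
    by_cases hzI : z ∈ I
    · rw [hg1 z hzI]
      have := (e ⟨z, hzI⟩).2
      have := Nat.card_coe_set_eq I
      omega
    · rw [hg2 z hzI]
      have := hd z ⟨hz, hzI⟩
      omega

/-- A connected set in which all paths from a given vertex have fewer than `d` edges has a
ranking with `d` ranks. -/
theorem exists_isRanking_of_pathTo_lt {d : ℕ} : ∀ {A : Set V} {x : V}, x ∈ A →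
    (∀ y ∈ A, ReachIn G A x y) →
    (∀ y D m, D ⊆ A → PathTo G x y D m → m < d) →
    ∃ f, IsRanking G A f ∧ ∀ z ∈ A, f z < d := by
  induction d with
  | zero =>
    intro A x hx _ hp
    exact absurd (hp x {x} 0 (by simpa using hx) .nil) (by omega)
  | succ d ih =>
    intro A x hx hc hp
    -- Depth-first search: `x` gets the top rank, and each component of the rest is entered at a
    -- neighbour of `x`, from which paths are one edge shorter.
    obtain ⟨f, hf, hfd⟩ : ∃ f, IsRanking G (A \ {x}) f ∧ ∀ z ∈ A \ {x}, f z < d := by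
      refine exists_isRanking_of_components fun z hz => ?_
      obtain ⟨a, b, ha, hbA, hbx, hab⟩ :=
        (hc z hz.1).symm.exists_step (B := {x}) hz.2 rfl
      obtain rfl : b = x := hbx
      have hK : {y | ReachIn G (A \ {b}) z y} ⊆ A \ {b} := fun y hy => hy.mem_right
      have := ih (A := {y | ReachIn G (A \ {b}) z y}) (x := a) ha ?_ ?_
      · exact this
      · intro y hy
        have h1 := (ha.symm.trans hy).within_component
        refine h1.mono fun t ht => ha.trans ht
      · intro y D m hD hpath
        have h2 := (PathTo.nil (G := G) (w := b)).append hab.symm hpath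
          (by
            rw [Set.disjoint_left]
            rintro _ rfl ht
            exact (hK (hD ht)).2 rfl)
        have h3 := hp _ _ _ (Set.union_subset (by simpa using hx)
          (hD.trans (hK.trans Set.sdiff_subset))) h2
        omega
    obtain ⟨g, hg, hgd⟩ := exists_isRanking_of_diff (Set.finite_singleton x) hf hfd
    exact ⟨g, hg, by simpa using hgd⟩

end Ranking

/-! ### Building the star from legs -/

section Star

variable {V : Type*} {G : SimpleGraph V} {w : V}

theorem subdividedStar_isContained_of_fun {n : ℕ} (a : Fin n → ℕ) (g : Fin n → ℕ → V)
    (h0 : ∀ i, 0 < a i → G.Adj w (g i 0))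
    (hadj : ∀ i j, j + 1 < a i → G.Adj (g i j) (g i (j + 1)))
    (hw : ∀ i j, j < a i → g i j ≠ w)
    (hinj : ∀ i j i' j', j < a i → j' < a i' → g i j = g i' j' → i = i' ∧ j = j') :
    (subdividedStar a).IsContained G := by
  let φ : Option (Σ i : Fin n, Fin (a i)) → V := fun x => x.elim w fun s => g s.1 s.2
  have hdir : ∀ x y, ((∃ (i : Fin n) (j : Fin (a i)), x = none ∧ y = some ⟨i, j⟩ ∧ (j : ℕ) = 0) ∨
      (∃ (i : Fin n) (j j' : Fin (a i)), x = some ⟨i, j⟩ ∧ y = some ⟨i, j'⟩ ∧ (j' : ℕ) = j + 1)) →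
      G.Adj (φ x) (φ y) := by
    rintro x y (⟨i, j, rfl, rfl, hj⟩ | ⟨i, j, j', rfl, rfl, hj⟩)
    · have := h0 i (by omega)
      simpa [φ, hj] using this
    · have := hadj i j (by omega)
      simpa [φ, hj] using this
  refine ⟨⟨⟨φ, ?_⟩, ?_⟩⟩
  · intro x y hxy
    rw [subdividedStar, fromRel_adj] at hxy
    rcases hxy.2 with h | h
    · exact hdir x y h
    · exact (hdir y x h).symm
  · rintro (_ | ⟨i, j⟩) (_ | ⟨i', j'⟩) h
    · rfl
    · exact absurd h.symm (hw i' j' j'.2)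
    · exact absurd h (hw i j j.2)
    · obtain ⟨rfl, e⟩ := hinj i j i' j' j.2 j'.2 h
      rw [Fin.ext e]

/-- Three legs of length at least `k` at `w` and a neighbour of `w` outside the legs. -/
theorem subdividedStar_isContained_of_legs {k : ℕ} {y : V} {W : Fin 3 → Set V} {v : Fin 3 → V}
    {l : Fin 3 → ℕ} (hp : ∀ i, PathTo G w (v i) (W i) (l i)) (hl : ∀ i, k ≤ l i)
    (hd : ∀ i j, i ≠ j → ∀ z ∈ W i, z ∈ W j → z = w)
    (hy : G.Adj w y) (hyW : ∀ i, y ∉ W i) :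
    (subdividedStar ![1, k, k, k]).IsContained G := by
  choose f h0 _ hadj hmem _ hinj using fun i => (hp i).exists_fun
  let a : Fin 4 → ℕ := Fin.cons 1 fun _ : Fin 3 => k
  let g : Fin 4 → ℕ → V := Fin.cons (fun _ => y) fun (i : Fin 3) j => f i (j + 1)
  have ha : ![1, k, k, k] = a := by
    ext i; fin_cases i <;> rfl
  rw [ha]
  have hne : ∀ i j, j < k → f i (j + 1) ≠ w := by
    intro i j hj e
    have := hl i
    rw [← h0 i] at e
    have := hinj i (j + 1) (by omega) 0 (by omega) e
    omega
  refine subdividedStar_isContained_of_fun (w := w) a g ?_ ?_ ?_ ?_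
  · intro i
    refine Fin.cases (fun _ => hy) (fun i hi => ?_) i
    have h1 : 0 < k := hi
    have := hadj i 0 (by have := hl i; omega)
    rwa [h0] at this
  · intro i
    refine Fin.cases (fun j hj => ?_) (fun i j hj => ?_) i
    · simp [a] at hj
    · have h1 : j + 1 < k := hj
      exact hadj i (j + 1) (by have := hl i; omega)
  · intro i
    refine Fin.cases (fun j hj => hy.ne') (fun i j hj => hne i j hj) i
  · intro i j i' j'
    refine Fin.cases (fun hj => ?_) (fun i hj => ?_) i <;>
    refine Fin.cases (fun hj' => ?_) (fun i' hj' => ?_) i' <;> intro e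
    · refine ⟨rfl, ?_⟩
      have h1 : j < 1 := hj
      have h2 : j' < 1 := hj'
      omega
    · have h2 : j' < k := hj'
      have e' : y = f i' (j' + 1) := e
      exact absurd (e' ▸ hmem i' (j' + 1) (by have := hl i'; omega)) (hyW i')
    · have h2 : j < k := hj
      have e' : f i (j + 1) = y := e
      exact absurd (e' ▸ hmem i (j + 1) (by have := hl i; omega)) (hyW i)
    · have h1 : j < k := hj
      have h2 : j' < k := hj'
      have e' : f i (j + 1) = f i' (j' + 1) := e
      have m1 := hmem i (j + 1) (by have := hl i; omega)
      have m2 := hmem i' (j' + 1) (by have := hl i'; omega)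
      by_cases hii : i = i'
      · subst hii
        have := hinj i (j + 1) (by have := hl i; omega) (j' + 1) (by have := hl i; omega) e'
        exact ⟨rfl, by omega⟩
      · exact absurd (hd i i' hii _ m1 (e' ▸ m2)) (hne i j h1)

/-- A long leg can be shortened so as to free a neighbour of its start. -/
theorem PathTo.exists_shortcut {v : V} {W : Set V} {k l : ℕ} (hk : 1 ≤ k)
    (h : PathTo G w v W l) (hl : 2 * k - 1 ≤ l) :
    ∃ e, ∀ y, G.Adj w y → y ≠ e → ∃ v' W' l', W' ⊆ W ∧ k ≤ l' ∧ PathTo G w v' W' l' ∧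
      ∃ y', G.Adj w y' ∧ y' ∉ W' ∧ (y' = y ∨ y' ∈ W) := by
  obtain ⟨f, h0, hv, hadj, hmem, hsurj, hinj⟩ := h.exists_fun
  -- Only the first vertex of the leg is useless. If `y = f m` with `m > k`, the leg is cut after
  -- `k` edges. If `2 ≤ m ≤ k`, it jumps from `w` to `f m`, which frees `f 1` and leaves `l - m + 1
  -- ≥ k` edges because `l ≥ 2k-1`.
  refine ⟨f 1, fun y hy hye => ?_⟩
  have hyw : y ≠ w := hy.ne'
  by_cases hyW : y ∈ W
  swap
  · exact ⟨v, W, l, subset_rfl, by omega, h, y, hy, hyW, Or.inl rfl⟩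
  obtain ⟨m, hm, rfl⟩ := hsurj y hyW
  have hm0 : m ≠ 0 := by rintro rfl; exact hyw h0
  have hm1 : m ≠ 1 := by rintro rfl; exact hye rfl
  by_cases hmk : k < m
  · have := PathTo.of_fun (G := G) (l := k) f (fun i hi => hadj i (by omega))
      (fun i hi j hj => hinj i (by omega) j (by omega))
    rw [h0] at this
    refine ⟨_, _, k, ?_, le_rfl, this, _, hy, ?_, Or.inl rfl⟩
    · rintro _ ⟨i, hi, rfl⟩
      have : i ≤ k := hi
      exact hmem i (by omega)
    · rintro ⟨i, hi, e⟩
      have h1 : i ≤ k := hi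
      have := hinj i (by omega) m hm e
      omega
  · let f' : ℕ → V := fun i => if i = 0 then w else f (m + (i - 1))
    have hf0 : f' 0 = w := rfl
    have hf1 : ∀ i, f' (i + 1) = f (m + i) := fun i => by simp [f']
    have hinj' : ∀ i ≤ l - m + 1, ∀ j ≤ l - m + 1, f' i = f' j → i = j := by
      intro i hi j hj e
      rcases i with _ | i <;> rcases j with _ | j
      · rfl
      · rw [hf0, hf1, ← h0] at e
        have := hinj 0 (by omega) _ (by omega) e
        omega
      · rw [hf0, hf1, ← h0] at e
        have := hinj _ (by omega) 0 (by omega) e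
        omega
      · rw [hf1, hf1] at e
        have := hinj _ (by omega) _ (by omega) e
        omega
    have := PathTo.of_fun (G := G) (l := l - m + 1) f' (by
      intro i hi
      rcases i with _ | i
      · rw [hf0, hf1]; exact hy
      · rw [hf1, hf1]
        exact hadj (m + i) (by omega)) hinj'
    rw [hf0] at this
    have ha1 := hadj 0 (by omega)
    rw [h0] at ha1
    refine ⟨_, _, _, ?_, ?_, this, f 1, ha1, ?_, Or.inr (hmem 1 (by omega))⟩
    · rintro _ ⟨i, hi, rfl⟩
      have hi' : i ≤ l - m + 1 := hi
      rcases i with _ | i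
      · rw [hf0]; exact h.mem_start
      · rw [hf1]; exact hmem _ (by omega)
    · omega
    · rintro ⟨i, hi, e⟩
      have hi' : i ≤ l - m + 1 := hi
      rcases i with _ | i
      · rw [hf0, ← h0] at e
        have := hinj 0 (by omega) 1 (by omega) e
        omega
      · rw [hf1] at e
        have := hinj _ (by omega) 1 (by omega) e
        omega

/-- There are disjoint legs of length at least `lam` at `w`, one for every element of `κ`. -/
def HasFan (G : SimpleGraph V) (w : V) (κ : Type*) (lam : ℕ) : Prop :=
  ∃ (W : κ → Set V) (v : κ → V) (l : κ → ℕ), (∀ s, PathTo G w (v s) (W s) (l s)) ∧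
    (∀ s, lam ≤ l s) ∧ ∀ s s', s ≠ s' → ∀ z ∈ W s, z ∈ W s' → z = w

theorem HasFan.reindex {κ κ' : Type*} {lam : ℕ} (h : HasFan G w κ lam) (e : κ' ↪ κ) :
    HasFan G w κ' lam := by
  obtain ⟨W, v, l, hp, hl, hd⟩ := h
  exact ⟨W ∘ e, v ∘ e, l ∘ e, fun s => hp _, fun s => hl _,
    fun s s' hne => hd _ _ (e.injective.ne hne)⟩

/-- Of three legs of length at least `k`, one has length at least `2k-1`. For all neighbours `y`
of `w` but one, the star exists if the other two legs avoid `y`. -/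
theorem exists_subdividedStar_isContained {k : ℕ} (hk : 1 ≤ k) {W : Fin 3 → Set V}
    {v : Fin 3 → V} {l : Fin 3 → ℕ} (hp : ∀ i, PathTo G w (v i) (W i) (l i)) (hl : ∀ i, k ≤ l i)
    (hd : ∀ i j, i ≠ j → ∀ z ∈ W i, z ∈ W j → z = w)
    (i₀ : Fin 3) (hi₀ : 2 * k - 1 ≤ l i₀) :
    ∃ e, ∀ y, G.Adj w y → y ≠ e → (∀ i, i ≠ i₀ → y ∉ W i) →
      (subdividedStar ![1, k, k, k]).IsContained G := by
  classical
  obtain ⟨e, he⟩ := (hp i₀).exists_shortcut hk hi₀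
  refine ⟨e, fun y hy hye hyW => ?_⟩
  obtain ⟨v', W', l', hW', hl', hp', y', hy', hyW', h⟩ := he y hy hye
  refine subdividedStar_isContained_of_legs (W := Function.update W i₀ W')
    (v := Function.update v i₀ v') (l := Function.update l i₀ l') (y := y') ?_ ?_ ?_ hy' ?_
  · intro i
    by_cases hi : i = i₀
    · subst hi; simpa using hp'
    · simpa [hi] using hp i
  · intro i
    by_cases hi : i = i₀
    · subst hi; simpa using hl'
    · simpa [hi] using hl i
  · have hsub : ∀ i, Function.update W i₀ W' i ⊆ W i := by
      intro i
      by_cases hi : i = i₀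
      · subst hi; simpa using hW'
      · simp [hi]
    intro i j hij z hz hz'
    exact hd i j hij z (hsub i hz) (hsub j hz')
  · intro i
    by_cases hi : i = i₀
    · subst hi; simpa using hyW'
    · simp only [Function.update_of_ne hi]
      rcases h with rfl | h
      · exact hyW i hi
      · intro h'
        have := hd i i₀ hi y' h' h
        exact hy'.ne' this

/-- Three long legs at a vertex of degree at least four. -/
theorem HasFan.subdividedStar_isContained [Fintype V] [DecidableRel G.Adj] {k : ℕ} (hk : 1 ≤ k)
    (h : HasFan G w (Fin 3) (2 * k - 1)) (hw : 4 ≤ G.degree w) :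
    (subdividedStar ![1, k, k, k]).IsContained G := by
  classical
  obtain ⟨W, v, l, hp, hl, hd⟩ := h
  choose e he using fun i₀ : Fin 3 =>
    exists_subdividedStar_isContained hk hp (fun i => by have := hl i; omega) hd i₀ (hl i₀)
  -- Each leg excludes one neighbour of `w`, so degree 4 leaves a choice.
  obtain ⟨y, hy, hye⟩ : ∃ y, G.Adj w y ∧ ∀ i, y ≠ e i := by
    by_contra hcon
    push Not at hcon
    have hsub : G.neighborFinset w ⊆ Finset.univ.image e := by
      intro y hy
      obtain ⟨i, hi⟩ := hcon y (by simpa using hy)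
      simp [hi]
    have h1 := Finset.card_le_card hsub
    have h2 := Finset.card_image_le (s := Finset.univ) (f := e)
    rw [G.card_neighborFinset_eq_degree] at h1
    simp at h2
    omega
  by_cases hyW : ∃ i₀, y ∈ W i₀
  · obtain ⟨i₀, hi₀⟩ := hyW
    exact he i₀ y hy (hye i₀) fun i hi h' => hy.ne' (hd i i₀ hi y h' hi₀)
  · push Not at hyW
    exact he 0 y hy (hye 0) fun i _ => hyW i

end Star
-- Tracks and the bridges between them
section Tracks

variable {V ι : Type*} {G : SimpleGraph V} {w : V}

/-- `R s 0, …, R s n` are paths starting at `w`, one for every `s`, that are disjoint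
except for `w`. -/
structure IsTracks (G : SimpleGraph V) (w : V) (n : ℕ) (R : ι → ℕ → V) : Prop where
  zero : ∀ s, R s 0 = w
  adj : ∀ s i, i < n → G.Adj (R s i) (R s (i + 1))
  inj : ∀ s i s' i', 0 < i → i ≤ n → i' ≤ n → R s i = R s' i' → s = s' ∧ i = i'

/-- The vertices on the tracks. -/
def onTracks (R : ι → ℕ → V) (n : ℕ) : Set V := {v | ∃ s i, i ≤ n ∧ R s i = v}

/-- The vertices on the tracks before the positions `a`. -/
def innerTracks (R : ι → ℕ → V) (a : ι → ℕ) : Set V := {v | ∃ s i, i < a s ∧ R s i = v}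

theorem innerTracks_mono {R : ι → ℕ → V} {b c : ι → ℕ} (h : ∀ s, b s ≤ c s) :
    innerTracks R b ⊆ innerTracks R c := by
  rintro _ ⟨s, i, hi, rfl⟩
  exact ⟨s, i, hi.trans_le (h s), rfl⟩

/-- There is an edge between `u` and `v` or a path whose interior lies in `A`. -/
def Bridged (G : SimpleGraph V) (A : Set V) (u v : V) : Prop :=
  G.Adj u v ∨ ∃ x y, G.Adj u x ∧ ReachIn G A x y ∧ G.Adj y v

/-- The interior vertices of walks through `A` between `u` and `v`. -/
def bridgeSet (G : SimpleGraph V) (A : Set V) (u v : V) : Set V :=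
  {z | ∃ x y, G.Adj u x ∧ ReachIn G A x y ∧ G.Adj y v ∧ ReachIn G A x z}

/-- The vertices that can be reached from `I` through `A`. -/
def attached (G : SimpleGraph V) (A I : Set V) : Set V :=
  {z | ∃ u ∈ I, ∃ x, G.Adj u x ∧ ReachIn G A x z}

theorem bridgeSet_subset {A : Set V} {u v : V} : bridgeSet G A u v ⊆ A :=
  fun _ ⟨_, _, _, _, _, h⟩ => h.mem_right

theorem bridgeSet_subset_attached {A I : Set V} {u v : V} (hu : u ∈ I) :
    bridgeSet G A u v ⊆ attached G A I :=
  fun _ ⟨x, _, hx, _, _, h⟩ => ⟨u, hu, x, hx, h⟩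

/-- The two walks through `A` meet at `z` and can be spliced there. This is what keeps new bridges
away from older legs. -/
theorem exists_bridged_of_mem {A I : Set V} {u v z : V} (hz : z ∈ bridgeSet G A u v)
    (hz' : z ∈ attached G A I) : ∃ u' ∈ I, Bridged G A u' v := by
  obtain ⟨x, y, -, hxy, hyv, hxz⟩ := hz
  obtain ⟨u', hu', x', hx', h⟩ := hz'
  exact ⟨u', hu', Or.inr ⟨x', y, hx', h.trans (hxz.symm.trans hxy), hyv⟩⟩

theorem Bridged.extend {A T : Set V} {u v : V} {t : ℕ} (h : Bridged G A u v)
    (hT : PathTo G w u T t) (hv : v ∉ T) (hvA : v ∉ A) (hd : Disjoint T (bridgeSet G A u v)) :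
    ∃ D ⊆ bridgeSet G A u v, ∃ t', t + 1 ≤ t' ∧ PathTo G w v (T ∪ insert v D) t' := by
  rcases h with h | ⟨x, y, hux, hxy, hyv⟩
  · refine ⟨∅, Set.empty_subset _, t + 1, le_rfl, ?_⟩
    have := hT.snoc h hv
    rwa [← Set.union_singleton, ← insert_empty_eq] at this
  · obtain ⟨D, hD, m, hp⟩ := hxy.within_component.exists_pathTo
    have hDb : D ⊆ bridgeSet G A u v := fun z hz => ⟨x, y, hux, hxy, hyv, hD hz⟩
    have h1 := hT.append hux hp (hd.mono_right hDb)
    have h2 := h1.snoc hyv (by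
      rintro (h' | h')
      · exact hv h'
      · exact hvA (bridgeSet_subset (hDb h')))
    refine ⟨D, hDb, t + 1 + m + 1, by omega, ?_⟩
    rwa [Set.union_insert]

namespace IsTracks

variable {n : ℕ} {R : ι → ℕ → V}

theorem extend_up (h : IsTracks G w n R) {s : ι} {p l : ℕ} {W : Set V}
    (hW : PathTo G w (R s p) W l) (m : ℕ) (hn : p + m ≤ n)
    (hd : ∀ i, p < i → i ≤ n → R s i ∉ W) :
    PathTo G w (R s (p + m)) (W ∪ R s '' Set.Ioc p (p + m)) (l + m) := by
  induction m with
  | zero => simpa using hW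
  | succ m ih =>
    have h1 := (ih (by omega)).snoc (h.adj s (p + m) (by omega)) (by
      rintro (h' | ⟨i, hi, e⟩)
      · exact hd _ (by omega) (by omega) h'
      · have := (h.inj s (p + m + 1) s i (by omega) (by omega) (by have := hi.2; omega) e.symm).2
        have := hi.2
        omega)
    have e : W ∪ R s '' Set.Ioc p (p + (m + 1)) =
        insert (R s (p + m + 1)) (W ∪ R s '' Set.Ioc p (p + m)) := by
      rw [← Set.union_insert, ← Set.image_insert_eq]
      congr 2
      ext i
      simp only [Set.mem_Ioc, Set.mem_insert_iff]
      omega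
    rw [e]
    exact h1

theorem extend_down (h : IsTracks G w n R) {s : ι} {q l : ℕ} (m : ℕ) {W : Set V}
    (hW : PathTo G w (R s (q + m)) W l) (hn : q + m ≤ n)
    (hd : ∀ i, q ≤ i → i < q + m → R s i ∉ W) :
    PathTo G w (R s q) (W ∪ R s '' Set.Ico q (q + m)) (l + m) := by
  induction m generalizing W l with
  | zero => simpa using hW
  | succ m ih =>
    have h1 := hW.snoc (h.adj s (q + m) (by omega)).symm (hd _ (by omega) (by omega))
    have h2 := ih h1 (by omega) (by
      rintro i hi hi' (e | e)
      · have := (h.inj s (q + m) s i (by omega) (by omega) (by omega) e.symm).2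
        omega
      · exact hd i hi (by omega) e)
    have e : W ∪ R s '' Set.Ico q (q + (m + 1)) =
        insert (R s (q + m)) W ∪ R s '' Set.Ico q (q + m) := by
      rw [Set.insert_union, ← Set.union_insert, ← Set.image_insert_eq]
      congr 2
      ext i
      simp only [Set.mem_Ico, Set.mem_insert_iff]
      omega
    have e2 : l + (m + 1) = l + 1 + m := by omega
    rw [e, e2]
    exact h2

end IsTracks

/-! ### Levels reached by bridges -/

/-- Starting from `{w}`, the part of the tracks before `a (j+1)` is as far as one can get by
bridges that start before `a j`. -/
structure IsLevels (G : SimpleGraph V) (R : ι → ℕ → V) (n : ℕ) (a : ℕ → ι → ℕ) : Prop where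
  zero : ∀ s, a 0 s = 1
  le_succ : ∀ j s, a j s ≤ a (j + 1) s
  le : ∀ j s, a j s ≤ n
  bridged : ∀ j s, a j s < a (j + 1) s →
    ∃ u ∈ innerTracks R (a j), Bridged G (onTracks R n)ᶜ u (R s (a (j + 1) s))
  max : ∀ j, ∀ u ∈ innerTracks R (a j), ∀ s i, i ≤ n →
    Bridged G (onTracks R n)ᶜ u (R s i) → i ≤ a (j + 1) s

theorem exists_isLevels (G : SimpleGraph V) (R : ι → ℕ → V) {n : ℕ} (hn : 1 ≤ n) :
    ∃ a, IsLevels G R n a := by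
  classical
  -- The disjunct `i = b s` is the default: a track on which no bridge lands further keeps its
  -- position.
  let P : (ι → ℕ) → ι → ℕ → Prop := fun b s i =>
    i = b s ∨ ∃ u ∈ innerTracks R b, Bridged G (onTracks R n)ᶜ u (R s i)
  have hdec : ∀ b s, DecidablePred (P b s) := fun _ _ => Classical.decPred _
  let a : ℕ → ι → ℕ := fun j => Nat.rec (fun _ => 1)
    (fun _ b s => Nat.findGreatest (P b s) n) j
  have hsucc : ∀ j s, a (j + 1) s = Nat.findGreatest (P (a j) s) n := fun _ _ => rfl
  have hle : ∀ j s, a j s ≤ n := by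
    intro j s
    cases j with
    | zero => exact hn
    | succ j => rw [hsucc]; exact Nat.findGreatest_le n
  refine ⟨a, fun _ => rfl, ?_, hle, ?_, ?_⟩
  · intro j s
    rw [hsucc]
    exact Nat.le_findGreatest (hle j s) (Or.inl rfl)
  · intro j s hlt
    have : P (a j) s (a (j + 1) s) := by
      rw [hsucc]
      exact Nat.findGreatest_spec (P := P (a j) s) (hle j s) (Or.inl rfl)
    rcases this with h | h
    · omega
    · exact h
  · intro j u hu s i hi hb
    rw [hsucc]
    exact Nat.le_findGreatest hi (Or.inr ⟨u, hu, hb⟩)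

theorem IsLevels.mono {R : ι → ℕ → V} {n : ℕ} {a : ℕ → ι → ℕ} (h : IsLevels G R n a)
    {i j : ℕ} (hij : i ≤ j) (s : ι) : a i s ≤ a j s :=
  monotone_nat_of_le_succ (f := fun j => a j s) (fun j => h.le_succ j s) hij

/-! ### Leg systems and rerouting across bridges -/

/-- Legs from `w` to `u` and to a vertex `R s (p s)` of every track, which meet the tracks only
up to the positions `p` and the rest of the graph only in parts attached to earlier levels. -/
structure LegSystem [Fintype ι] (G : SimpleGraph V) (w : V) (R : ι → ℕ → V) (n : ℕ)
    (a : ℕ → ι → ℕ) (lam j : ℕ) (u : V) where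
  legs : Option ι → Set V
  pos : ι → ℕ
  len : Option ι → ℕ
  -- Lengths are not bounded, since a bridge may be long. The weights are lower bounds for them
  -- capped at `lam`, so that `count` limits the level `j`.
  weight : ι → ℕ
  path_none : PathTo G w u (legs none) (len none)
  path_some : ∀ s, PathTo G w (R s (pos s)) (legs (some s)) (len (some s))
  weight_le_len : ∀ s, weight s ≤ len (some s)
  weight_le : ∀ s, weight s ≤ lam
  count : j + Fintype.card ι ≤ len none + ∑ s, weight s
  one_le_len : ∀ s, 1 ≤ len (some s)
  pos_le : ∀ s, pos s ≤ a j s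
  disj : ∀ o o', o ≠ o' → ∀ z ∈ legs o, z ∈ legs o' → z = w
  avoid : ∀ o s i, pos s < i → i ≤ n → R s i ∉ legs o
  earlier : ∀ o, ∀ z ∈ legs o, z ∉ onTracks R n →
    ∃ j' < j, z ∈ attached G (onTracks R n)ᶜ (innerTracks R (a j'))

/-- For prolonging legs that may have exchanged names: `P (e o)` is an old leg and `X o` its new
end. -/
theorem disjoint_union_of_perm {κ : Type*} {P X : κ → Set V} (e : Equiv.Perm κ)
    (hP : ∀ o o', o ≠ o' → ∀ z ∈ P o, z ∈ P o' → z = w)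
    (hX : ∀ o o', o ≠ o' → ∀ z ∈ X o, z ∉ X o') (hPX : ∀ o o', ∀ z ∈ X o, z ∉ P o') :
    ∀ o o', o ≠ o' → ∀ z ∈ P (e o) ∪ X o, z ∈ P (e o') ∪ X o' → z = w := by
  rintro o o' hne z (h | h) (h' | h')
  · exact hP _ _ (e.injective.ne hne) z h h'
  · exact absurd h (hPX o' _ z h')
  · exact absurd h' (hPX o _ z h)
  · exact absurd h' (hX o o' hne z h)

namespace LegSystem

variable [Fintype ι] {n : ℕ} {R : ι → ℕ → V} {a : ℕ → ι → ℕ} {lam j : ℕ} {u : V}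

/-- The legs on tracks become long by running on along their tracks for `lam` more steps; only the
leg to `u` needs outside help. -/
theorem hasFan_of_extension (hR : IsTracks G w n R) (c : LegSystem G w R n a lam j u)
    (hp : ∀ s, c.pos s + lam ≤ n) {D : Set V} {v : V} {t : ℕ}
    (hpath : PathTo G w v (c.legs none ∪ D) t) (ht : lam ≤ t) (hD : ∀ z ∈ D, z ∉ onTracks R n)
    (hDl : ∀ o, ∀ z ∈ D, z ∉ c.legs o) : HasFan G w (Option ι) lam := by
  let X : Option ι → Set V := fun o => o.elim D fun s => R s '' Set.Ioc (c.pos s) (c.pos s + lam)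
  have hX : ∀ s, ∀ z ∈ X (some s), ∃ i, i ≤ n ∧ R s i = z ∧ c.pos s < i := by
    rintro s z ⟨i, hi, rfl⟩
    exact ⟨i, hi.2.trans (hp s), rfl, hi.1⟩
  refine ⟨fun o => c.legs (Equiv.refl _ o) ∪ X o,
    fun o => o.elim v fun s => R s (c.pos s + lam),
    fun o => o.elim t fun s => c.len (some s) + lam, ?_, ?_, ?_⟩
  · rintro (_ | s)
    · exact hpath
    · exact hR.extend_up (c.path_some s) lam (hp s) (c.avoid (some s) s)
  · rintro (_ | s)
    · exact ht
    · exact Nat.le_add_left _ _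
  · refine disjoint_union_of_perm _ c.disj ?_ ?_
    · rintro (_ | s) (_ | s') hne z h h'
      · exact hne rfl
      · obtain ⟨i, hi, e, -⟩ := hX s' z h'
        exact hD z h ⟨s', i, hi, e⟩
      · obtain ⟨i, hi, e, -⟩ := hX s z h
        exact hD z h' ⟨s, i, hi, e⟩
      · obtain ⟨i, hi, rfl, h1⟩ := hX s z h
        obtain ⟨i', hi', e, -⟩ := hX s' _ h'
        exact hne (congrArg some (hR.inj s i s' i' (by omega) hi hi' e.symm).1)
    · rintro (_ | s) o' z h
      · exact hDl o' z h
      · obtain ⟨i, hi, rfl, h1⟩ := hX s z h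
        exact c.avoid o' s i h1 hi

theorem hasFan_of_le (hR : IsTracks G w n R) (c : LegSystem G w R n a lam j u)
    (hp : ∀ s, c.pos s + lam ≤ n) (ht : lam ≤ c.len none) : HasFan G w (Option ι) lam :=
  c.hasFan_of_extension hR hp (D := ∅) (by simpa using c.path_none) ht (by simp) (by simp)

/-- A common vertex would be attached to an earlier level, which would then itself have a bridge to
`R s f`, contrary to the maximality of the levels. -/
theorem disjoint_bridgeSet (hL : IsLevels G R n a) (c : LegSystem G w R n a lam j u)
    {s : ι} {f : ℕ} (hf : a j s < f) (hfn : f ≤ n) (o : Option ι) :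
    Disjoint (c.legs o) (bridgeSet G (onTracks R n)ᶜ u (R s f)) := by
  rw [Set.disjoint_left]
  intro z hz hzb
  obtain ⟨j', hj', hza⟩ := c.earlier o z hz (bridgeSet_subset hzb)
  obtain ⟨u', hu', hb⟩ := exists_bridged_of_mem hzb hza
  have h1 := hL.max j' u' hu' s f hfn hb
  have h2 := hL.mono (show j' + 1 ≤ j by omega) s
  omega

/-- A bridge from `u` far along a track yields long legs. -/
theorem hasFan_of_far (hR : IsTracks G w n R) (hL : IsLevels G R n a)
    (c : LegSystem G w R n a lam j u) (hp : ∀ s, c.pos s + lam ≤ n) {s : ι} {f : ℕ}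
    (hb : Bridged G (onTracks R n)ᶜ u (R s f)) (hf : a j s < f) (hfn : f ≤ n)
    (hfar : c.pos s + 2 * lam < f) : HasFan G w (Option ι) lam := by
  classical
  have hsf : R s f ∈ onTracks R n := ⟨s, f, hfn, rfl⟩
  obtain ⟨D, hD, t', ht', hpath⟩ := hb.extend c.path_none (c.avoid none s f (by omega) hfn)
    (fun h => h hsf) (c.disjoint_bridgeSet hL hf hfn none)
  have hDc : ∀ z ∈ D, z ∉ onTracks R n := fun z hz => bridgeSet_subset (hD hz)
  have hDl : ∀ o, ∀ z ∈ D, z ∉ c.legs o := fun o z hz h =>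
    Set.disjoint_left.1 (c.disjoint_bridgeSet hL hf hfn o) h (hD hz)
  -- The leg to `u` crosses to `R s f` and walks `lam` steps down the track, while the old leg there
  -- walks `lam` steps up; `hfar` keeps the stretches apart. The two legs exchange names, hence the
  -- swap below.
  let X : Option ι → Set V := fun o => o.elim (R s '' Set.Ioc (c.pos s) (c.pos s + lam))
    fun s' => if s' = s then insert (R s f) D ∪ R s '' Set.Ico (f - lam) f
      else R s' '' Set.Ioc (c.pos s') (c.pos s' + lam)
  have hXs : X (some s) = insert (R s f) D ∪ R s '' Set.Ico (f - lam) f := if_pos rfl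
  have hXne : ∀ s', s' ≠ s → X (some s') = R s' '' Set.Ioc (c.pos s') (c.pos s' + lam) :=
    fun s' h => if_neg h
  have hXmem : ∀ o, ∀ z ∈ X o, (z ∈ D ∧ o = some s) ∨ ∃ s' i, i ≤ n ∧ R s' i = z ∧
      c.pos s' < i ∧ (o = none → s' = s ∧ i ≤ c.pos s + lam) ∧
      (∀ s'', o = some s'' → s'' = s' ∧ (s' = s → c.pos s + lam < i)) := by
    rintro (_ | s') z hz
    · obtain ⟨i, hi, rfl⟩ := hz
      have h1 := hp s
      have h2 := hi.2
      exact Or.inr ⟨s, i, by omega, rfl, hi.1, fun _ => ⟨rfl, hi.2⟩, fun _ h => by simp at h⟩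
    · by_cases hs' : s' = s
      · subst hs'
        rw [hXs] at hz
        rcases hz with (rfl | hz) | ⟨i, hi, rfl⟩
        · exact Or.inr ⟨s', f, hfn, rfl, by omega, fun h => by simp at h,
            fun s'' h => ⟨(Option.some.inj h).symm, fun _ => by omega⟩⟩
        · exact Or.inl ⟨hz, rfl⟩
        · have h1 := hi.1
          have h2 := hi.2
          exact Or.inr ⟨s', i, by omega, rfl, by omega, fun h => by simp at h,
            fun s'' h => ⟨(Option.some.inj h).symm, fun _ => by omega⟩⟩
      · rw [hXne s' hs'] at hz
        obtain ⟨i, hi, rfl⟩ := hz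
        have h1 := hp s'
        have h2 := hi.2
        exact Or.inr ⟨s', i, by omega, rfl, hi.1, fun h => by simp at h,
          fun s'' h => ⟨(Option.some.inj h).symm, fun h' => absurd h' hs'⟩⟩
  have hpath' : PathTo G w (R s (f - lam))
      (c.legs none ∪ insert (R s f) D ∪ R s '' Set.Ico (f - lam) f) (t' + lam) := by
    have e : f = f - lam + lam := by omega
    have := hR.extend_down (q := f - lam) lam (s := s) (W := c.legs none ∪ insert (R s f) D)
      (l := t') (by rwa [← e]) (by omega) (by
        rintro i hi hi' (h | h | h)
        · exact c.avoid none s i (by omega) (by omega) h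
        · have := (hR.inj s f s i (by omega) hfn (by omega) h.symm).2
          omega
        · exact hDc _ h ⟨s, i, by omega, rfl⟩)
    rwa [← e] at this
  refine ⟨fun o => c.legs (Equiv.swap none (some s) o) ∪ X o,
    fun o => o.elim (R s (c.pos s + lam)) fun s' => if s' = s then R s (f - lam)
      else R s' (c.pos s' + lam),
    fun o => o.elim (c.len (some s) + lam) fun s' => if s' = s then t' + lam
      else c.len (some s') + lam, ?_, ?_, ?_⟩
  · rintro (_ | s')
    · dsimp only
      rw [Equiv.swap_apply_left]
      exact hR.extend_up (c.path_some s) lam (hp s) (c.avoid (some s) s)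
    · by_cases hs' : s' = s
      · subst hs'
        simp only [Option.elim, if_true, Equiv.swap_apply_right, hXs]
        rwa [← Set.union_assoc]
      · dsimp only
        rw [Equiv.swap_apply_of_ne_of_ne (by simp) (by simpa using hs'), hXne s' hs']
        simp only [Option.elim, if_neg hs']
        exact hR.extend_up (c.path_some s') lam (hp s') (c.avoid (some s') s')
  · rintro (_ | s')
    · exact Nat.le_add_left _ _
    · simp only [Option.elim]
      split_ifs <;> omega
  · refine disjoint_union_of_perm _ c.disj ?_ ?_
    · intro o o' hne z h h'
      rcases hXmem o z h with ⟨hzD, ho⟩ | ⟨s₁, i, hi, hiz, -, h2, h3⟩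
      · rcases hXmem o' z h' with ⟨-, ho'⟩ | ⟨s₂, i', hi', hiz', -⟩
        · exact hne (ho.trans ho'.symm)
        · exact hDc z hzD ⟨s₂, i', hi', hiz'⟩
      · rcases hXmem o' z h' with ⟨hzD, -⟩ | ⟨s₂, i', hi', hiz', hp', h2', h3'⟩
        · exact hDc z hzD ⟨s₁, i, hi, hiz⟩
        · obtain ⟨rfl, rfl⟩ := hR.inj s₂ i' s₁ i (by omega) hi' hi (hiz'.trans hiz.symm)
          rcases o with _ | o <;> rcases o' with _ | o'
          · exact hne rfl
          · have e1 := h2 rfl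
            have e2 := (h3' o' rfl).2 e1.1
            omega
          · have e1 := h2' rfl
            have e2 := (h3 o rfl).2 e1.1
            omega
          · exact hne (by rw [(h3 o rfl).1, (h3' o' rfl).1])
    · intro o o' z h
      rcases hXmem o z h with ⟨hzD, ho⟩ | ⟨s₁, i, hi, rfl, hpi, -⟩
      · exact hDl o' z hzD
      · exact c.avoid o' s₁ i hpi hi

/-- Let the leg to `u` take over the track of `s` along a bridge to `R s f`, and let the previous
leg on this track run on to `R s m`. -/
theorem exists_step (hR : IsTracks G w n R) (hL : IsLevels G R n a)
    (c : LegSystem G w R n a lam j u) {s : ι} {m : ℕ}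
    (hb : Bridged G (onTracks R n)ᶜ u (R s (a (j + 1) s))) (hf : a j s < a (j + 1) s)
    (hu : u ∈ innerTracks R (a j)) (hpm : c.pos s ≤ m) (hm : m < a (j + 1) s)
    (ht : c.len none < lam) :
    ∃ c' : LegSystem G w R n a lam (j + 1) (R s m),
      c'.len none = c.len (some s) + (m - c.pos s) ∧
      ∀ s', c'.pos s' = c.pos s' ∨ s' = s ∧ c'.pos s' = a (j + 1) s := by
  classical
  set f := a (j + 1) s with hfdef
  have hfn : f ≤ n := hL.le _ _
  have hpf : c.pos s < f := lt_of_le_of_lt (c.pos_le s) hf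
  have hsf : R s f ∈ onTracks R n := ⟨s, f, hfn, rfl⟩
  obtain ⟨D, hD, t', ht', hpath⟩ := hb.extend c.path_none (c.avoid none s f hpf hfn)
    (fun h => h hsf) (c.disjoint_bridgeSet hL hf hfn none)
  have hDc : ∀ z ∈ D, z ∉ onTracks R n := fun z hz => bridgeSet_subset (hD hz)
  have hDl : ∀ o, ∀ z ∈ D, z ∉ c.legs o := fun o z hz h =>
    Set.disjoint_left.1 (c.disjoint_bridgeSet hL hf hfn o) h (hD hz)
  let X : Option ι → Set V := fun o => o.elim (R s '' Set.Ioc (c.pos s) m)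
    fun s' => if s' = s then insert (R s f) D else ∅
  have hXs : X (some s) = insert (R s f) D := if_pos rfl
  have hXne : ∀ s', s' ≠ s → X (some s') = ∅ := fun s' h => if_neg h
  have hXmem : ∀ o, ∀ z ∈ X o, (z ∈ D ∧ o = some s) ∨ ∃ i, i ≤ f ∧ R s i = z ∧
      c.pos s < i ∧ (o = none ∧ i ≤ m ∨ o = some s ∧ i = f) := by
    rintro (_ | s') z hz
    · obtain ⟨i, hi, rfl⟩ := hz
      have h2 := hi.2
      exact Or.inr ⟨i, by omega, rfl, hi.1, Or.inl ⟨rfl, hi.2⟩⟩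
    · by_cases hs' : s' = s
      · subst hs'
        rw [hXs] at hz
        rcases hz with rfl | hz
        · exact Or.inr ⟨f, le_rfl, rfl, by omega, Or.inr ⟨rfl, rfl⟩⟩
        · exact Or.inl ⟨hz, rfl⟩
      · rw [hXne s' hs'] at hz
        exact absurd hz (Set.notMem_empty z)
  have hswap : ∀ s', s' ≠ s → Equiv.swap none (some s) (some s') = some s' := fun s' hs' =>
    Equiv.swap_apply_of_ne_of_ne (by simp) (by simpa using hs')
  refine ⟨{
    legs := fun o => c.legs (Equiv.swap none (some s) o) ∪ X o
    pos := Function.update c.pos s f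
    len := fun o => o.elim (c.len (some s) + (m - c.pos s))
      fun s' => if s' = s then t' else c.len (some s')
    weight := Function.update c.weight s (c.len none + 1)
    path_none := ?_
    path_some := ?_
    weight_le_len := ?_
    weight_le := ?_
    count := ?_
    one_le_len := ?_
    pos_le := ?_
    disj := ?_
    avoid := ?_
    earlier := ?_ }, rfl, ?_⟩
  · rw [Equiv.swap_apply_left]
    have := hR.extend_up (c.path_some s) (m - c.pos s) (by omega) (c.avoid (some s) s)
    rwa [Nat.add_sub_cancel' hpm] at this
  · intro s'
    by_cases hs' : s' = s
    · subst hs'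
      simpa [hXs] using hpath
    · have := c.path_some s'
      simpa [hs', hXne s' hs', hswap s' hs'] using this
  · intro s'
    by_cases hs' : s' = s
    · subst hs'
      simpa using ht'
    · simpa [hs'] using c.weight_le_len s'
  · intro s'
    by_cases hs' : s' = s
    · subst hs'
      simpa using ht
    · simpa [hs'] using c.weight_le s'
  -- The new free leg is at least as long as the lost weight of `s`; the new weight is the old free
  -- length plus one for the bridge. So the total grows by at least one.
  · have h1 := c.count
    have h2 := c.weight_le_len s
    have h3 : ∑ s', Function.update c.weight s (c.len none + 1) s' + c.weight s =
        c.len none + 1 + ∑ s', c.weight s' := by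
      rw [Finset.sum_update_of_mem (Finset.mem_univ s), ← Finset.add_sum_erase _ _
        (Finset.mem_univ s), Finset.sdiff_singleton_eq_erase]
      ring
    simp only [Option.elim]
    omega
  · intro s'
    simp only [Option.elim]
    split_ifs
    · omega
    · exact c.one_le_len s'
  · intro s'
    by_cases hs' : s' = s
    · subst hs'
      simp [hfdef]
    · simpa [hs'] using (c.pos_le s').trans (hL.le_succ j s')
  · refine disjoint_union_of_perm _ c.disj ?_ ?_
    · intro o o' hne z h h'
      rcases hXmem o z h with ⟨hzD, ho⟩ | ⟨i, hi, hiz, hpi, h1⟩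
      · rcases hXmem o' z h' with ⟨-, ho'⟩ | ⟨i', hi', hiz', -⟩
        · exact hne (ho.trans ho'.symm)
        · exact hDc z hzD ⟨s, i', by omega, hiz'⟩
      · rcases hXmem o' z h' with ⟨hzD, -⟩ | ⟨i', hi', hiz', hpi', h1'⟩
        · exact hDc z hzD ⟨s, i, by omega, hiz⟩
        · have := (hR.inj s i s i' (by omega) (by omega) (by omega) (hiz.trans hiz'.symm)).2
          subst this
          rcases h1 with ⟨h1, h2⟩ | ⟨h1, h2⟩ <;> rcases h1' with ⟨h1', h2'⟩ | ⟨h1', h2'⟩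
          · exact hne (h1.trans h1'.symm)
          · omega
          · omega
          · exact hne (h1.trans h1'.symm)
    · intro o o' z h
      rcases hXmem o z h with ⟨hzD, ho⟩ | ⟨i, hi, rfl, hpi, -⟩
      · exact hDl o' z hzD
      · exact c.avoid o' s i hpi (by omega)
  · intro o s' i hi hin h
    have hpos : c.pos s' < i := by
      by_cases hs' : s' = s
      · subst hs'
        simp only [Function.update_self] at hi
        omega
      · simpa [hs'] using hi
    rcases h with h | h
    · exact c.avoid _ s' i hpos hin h
    · rcases hXmem o _ h with ⟨hzD, -⟩ | ⟨i', hi', e, -⟩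
      · exact hDc _ hzD ⟨s', i, hin, rfl⟩
      · obtain ⟨rfl, rfl⟩ := hR.inj s' i s i' (by omega) hin (by omega) e.symm
        simp only [Function.update_self] at hi
        omega
  · rintro o z (h | h) hz
    · obtain ⟨j', hj', h'⟩ := c.earlier _ z h hz
      exact ⟨j', by omega, h'⟩
    · rcases hXmem o _ h with ⟨hzD, -⟩ | ⟨i', hi', e, -⟩
      · exact ⟨j, by omega, bridgeSet_subset_attached hu (hD hzD)⟩
      · exact absurd ⟨s, i', by omega, e⟩ hz
  · intro s'
    by_cases hs' : s' = s
    · subst hs'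
      exact Or.inr ⟨rfl, by simp⟩
    · exact Or.inl (by simp [hs'])

/-- The legs before the first step. -/
theorem exists_zero [Nonempty ι] (hR : IsTracks G w n R) (hL : IsLevels G R n a) (hn : 1 ≤ n)
    (hlam : 1 ≤ lam) : Nonempty (LegSystem G w R n a lam 0 w) := by
  refine ⟨{
    legs := fun o => o.elim {w} fun s => {w, R s 1}
    pos := fun _ => 1
    len := fun o => o.elim 0 fun _ => 1
    weight := fun _ => 1
    path_none := .nil
    path_some := ?_
    weight_le_len := fun _ => le_rfl
    weight_le := fun _ => hlam
    count := by simp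
    one_le_len := fun _ => le_rfl
    pos_le := fun s => (hL.zero s).ge
    disj := ?_
    avoid := ?_
    earlier := ?_ }⟩
  · intro s
    have h := hR.adj s 0 (by omega)
    rw [hR.zero] at h
    have := (PathTo.nil (G := G) (w := w)).snoc h (fun e => h.ne (Set.mem_singleton_iff.1 e).symm)
    rwa [Set.pair_comm] at this
  · rintro (_ | s) (_ | s') hne z h h'
    · exact h
    · exact h
    · exact h'
    · rcases h with h | h
      · exact h
      · rcases h' with h' | h'
        · exact h'
        · exact absurd (hR.inj s 1 s' 1 one_pos hn hn (h.symm.trans h')).1 (by simpa using hne)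
  · rintro (_ | s) s' i hi hin h
    · have h : R s' i = w := h
      rw [← hR.zero s'] at h
      have := (hR.inj s' i s' 0 (by omega) hin (by omega) h).2
      omega
    · rcases h with h | h
      · rw [← hR.zero s'] at h
        have := (hR.inj s' i s' 0 (by omega) hin (by omega) h).2
        omega
      · have := (hR.inj s' i s 1 (by omega) hin hn h).2
        omega
  · rintro (_ | s) z h hz
    · exact absurd ⟨Classical.arbitrary ι, 0, by omega, (hR.zero _).trans h.symm⟩ hz
    · rcases h with h | h
      · exact absurd ⟨s, 0, by omega, (hR.zero s).trans h.symm⟩ hz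
      · exact absurd ⟨s, 1, hn, h.symm⟩ hz

end LegSystem

end Tracks
theorem PathTo.reachIn {V : Type*} {G : SimpleGraph V} {w v : V} {W : Set V} {l : ℕ}
    (h : PathTo G w v W l) : ∀ z ∈ W, ReachIn G W w z := by
  induction h with
  | nil => rintro z rfl; exact .refl rfl
  | @snoc v x W l h ha hx ih =>
    rintro z (rfl | hz)
    · exact ((ih v h.mem_end).mono (Set.subset_insert _ _)).tail ha (Or.inl rfl)
    · exact (ih z hz).mono (Set.subset_insert _ _)

/-! ### The levels stall: existence of a frontier -/

section Frontier

variable {V ι : Type*} [Fintype ι] [Nonempty ι] {G : SimpleGraph V} {w : V}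
  {n : ℕ} {R : ι → ℕ → V} {a : ℕ → ι → ℕ} {lam : ℕ}

/-- Without long legs the levels grow slowly, and all vertices before a level are reached by a
leg system. -/
theorem IsLevels.le_and_exists_legSystem (hL : IsLevels G R n a) (hR : IsTracks G w n R)
    (hlam : 1 ≤ lam) (hF : ¬ HasFan G w (Option ι) lam) :
    ∀ j, j * (lam - 1) + 1 + 3 * lam ≤ n → (∀ s, a j s ≤ j * (lam - 1) + 1) ∧
      ∀ u ∈ innerTracks R (a j), (∀ j' < j, u ∉ innerTracks R (a j')) →
        Nonempty (LegSystem G w R n a lam j u) := by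
  intro j
  induction j with
  | zero =>
    intro hn
    refine ⟨fun s => by rw [hL.zero s]; omega, ?_⟩
    rintro _ ⟨s, i, hi, rfl⟩ -
    rw [hL.zero s] at hi
    obtain rfl : i = 0 := by omega
    rw [hR.zero]
    exact LegSystem.exists_zero hR hL (by omega) hlam
  | succ j ih =>
    intro hn
    have hstep : (j + 1) * (lam - 1) = j * (lam - 1) + (lam - 1) := by ring
    obtain ⟨ihle, ihc⟩ := ih (by omega)
    have hpos : ∀ {u} (c : LegSystem G w R n a lam j u) s, c.pos s + 3 * lam ≤ n := by
      intro u c s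
      have h1 := c.pos_le s
      have h2 := ihle s
      omega
    have main : ∀ s, a j s < a (j + 1) s →
        a (j + 1) s ≤ (j + 1) * (lam - 1) + 1 ∧
        ∀ m, a j s ≤ m → m < a (j + 1) s →
          Nonempty (LegSystem G w R n a lam (j + 1) (R s m)) := by
      intro s hs
      obtain ⟨v, hv, hb⟩ := hL.bridged j s hs
      -- A bridge from an earlier source could not land beyond `a j s`.
      have hfresh : ∀ j' < j, v ∉ innerTracks R (a j') := by
        intro j' hj' hv'
        have h1 := hL.max j' v hv' s _ (hL.le _ _) hb
        have h2 := hL.mono (show j' + 1 ≤ j by omega) s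
        omega
      obtain ⟨c⟩ := ihc v hv hfresh
      have hcp := c.pos_le s
      have ht : c.len none < lam := by
        by_contra h
        exact hF (c.hasFan_of_le hR (fun s => by have := hpos c s; omega) (by omega))
      -- This coarse bound comes first: after the step the position is `a (j + 1) s`, and `lam` more
      -- track vertices must still fit, which uses up the slack `3 * lam`.
      have hnear : a (j + 1) s ≤ c.pos s + 2 * lam := by
        by_contra h
        exact hF (c.hasFan_of_far hR hL (fun s => by have := hpos c s; omega) hb hs (hL.le _ _)
          (by omega))
      have hstep' := fun m hpm hm => c.exists_step hR hL (m := m) hb hs hv hpm hm ht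
      refine ⟨?_, fun m hm hm' => (hstep' m (by omega) hm').nonempty⟩
      -- The displaced leg runs to just below the landing point. It must stay shorter than `lam`, so
      -- a level grows by at most `lam - 1`.
      obtain ⟨c', hlen, hpos'⟩ := hstep' (a (j + 1) s - 1) (by omega) (by omega)
      have ht' : c'.len none < lam := by
        by_contra h
        refine hF (c'.hasFan_of_le hR (fun s' => ?_) (by omega))
        rcases hpos' s' with h | ⟨rfl, h⟩
        · have := hpos c s'; omega
        · have := hpos c s'; omega
      have h1 := c.one_le_len s
      have h2 := ihle s
      omega
    refine ⟨fun s => ?_, ?_⟩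
    · rcases (hL.le_succ j s).lt_or_eq with h | h
      · exact (main s h).1
      · have := ihle s
        omega
    · rintro _ ⟨s, m, hm, rfl⟩ hfresh
      have hms : a j s ≤ m := by
        by_contra h
        exact hfresh j (by omega) ⟨s, m, by omega, rfl⟩
      exact (main s (by omega)).2 m hms hm

/-- If there is no fan of long legs at the start of long tracks, then there is a bounded part of
the tracks that no bridge leaves. -/
theorem IsTracks.exists_frontier (hR : IsTracks G w n R) (hlam : 1 ≤ lam)
    (hn : (Fintype.card ι + 1) * (lam - 1) ^ 2 + 4 * lam ≤ n)
    (hF : ¬ HasFan G w (Option ι) lam) :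
    ∃ b : ι → ℕ, (∀ s, 1 ≤ b s ∧ b s ≤ (Fintype.card ι + 1) * (lam - 1) ^ 2 + 1) ∧
      (∀ u ∈ innerTracks R b, ∀ s i, i ≤ n → Bridged G (onTracks R n)ᶜ u (R s i) → i ≤ b s) ∧
      (∀ s, b s = 1 ∨ ∃ u ∈ innerTracks R b, u ≠ R s (b s - 1) ∧
        Bridged G (onTracks R n)ᶜ u (R s (b s))) ∧
      ∀ z ∈ attached G (onTracks R n)ᶜ (innerTracks R b), ∃ x, ReachIn G (onTracks R n)ᶜ x z ∧
        ∀ y D m, D ⊆ (onTracks R n)ᶜ → PathTo G x y D m → m + 1 < lam := by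
  classical
  obtain ⟨a, hL⟩ := exists_isLevels G R (n := n) (by omega)
  set r := Fintype.card ι
  obtain ⟨μ, rfl⟩ : ∃ μ, lam = μ + 1 := ⟨lam - 1, by omega⟩
  rw [Nat.add_sub_cancel] at hn ⊢
  have key := hL.le_and_exists_legSystem hR hlam hF
  rw [Nat.add_sub_cancel] at key
  have hJ : ∀ j, j ≤ (r + 1) * μ + 1 → j * μ + 1 + 3 * (μ + 1) ≤ n := by
    intro j hj
    have : j * μ ≤ ((r + 1) * μ + 1) * μ := Nat.mul_le_mul_right _ hj
    nlinarith
  -- Without a fan, free length plus weights is at most `μ + r * (μ + 1)`, too little for the count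
  -- at level `J + 1`. So no vertex is new at that level.
  set J := (r + 1) * μ with hJdef
  have hshort : ∀ {j u} (c : LegSystem G w R n a (μ + 1) j u), j ≤ J + 1 →
      ∀ s, c.pos s + (μ + 1) ≤ n := by
    intro j u c hj s
    have h1 := c.pos_le s
    have h2 := (key j (hJ j hj)).1 s
    have h3 := hJ j hj
    omega
  have hstall : ∀ s, a (J + 1) s = a J s := by
    intro s
    by_contra hne
    have hlt : a J s < a (J + 1) s := lt_of_le_of_ne (hL.le_succ J s) (Ne.symm hne)
    have hfresh : ∀ j' < J + 1, R s (a J s) ∉ innerTracks R (a j') := by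
      rintro j' hj' ⟨s', i, hi, e⟩
      have h1 := hL.le j' s'
      have h2 := hL.mono (show 0 ≤ J by omega) s
      rw [hL.zero] at h2
      obtain ⟨rfl, rfl⟩ := hR.inj s (a J s) s' i (by omega) (hL.le _ _) (by omega) e.symm
      have h3 := hL.mono (show j' ≤ J by omega) s
      omega
    obtain ⟨c⟩ := (key (J + 1) (hJ _ le_rfl)).2 _ ⟨s, a J s, hlt, rfl⟩ hfresh
    have ht : c.len none ≤ μ := by
      by_contra h
      exact hF (c.hasFan_of_le hR (hshort c le_rfl) (by omega))
    have h1 := c.count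
    have h2 : ∑ s, c.weight s ≤ r * (μ + 1) := by
      refine (Finset.sum_le_sum fun s _ => c.weight_le s).trans ?_
      simp [r]
    have h3 : Fintype.card ι = r := rfl
    rw [h3] at h1
    nlinarith
  refine ⟨a J, fun s => ⟨?_, ?_⟩, ?_, ?_, ?_⟩
  · have := hL.mono (Nat.zero_le J) s
    rwa [hL.zero] at this
  · have := (key J (hJ J (by omega))).1 s
    calc a J s ≤ J * μ + 1 := this
      _ = _ := by rw [hJdef]; ring
  · intro u hu s i hi hb
    rw [← hstall s]
    exact hL.max J u hu s i hi hb
  · intro s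
    -- The witness is the source of the last bridge that moved the position on `s`. If it lies on
    -- the same track, it lies before the previous position, so it is not the predecessor of the
    -- landing point.
    have hgen : ∀ j ≤ J, a j s = 1 ∨ ∃ u ∈ innerTracks R (a J), u ≠ R s (a j s - 1) ∧
        Bridged G (onTracks R n)ᶜ u (R s (a j s)) := by
      intro j
      induction j with
      | zero => exact fun _ => Or.inl (hL.zero s)
      | succ j ih =>
        intro hj
        rcases (hL.le_succ j s).lt_or_eq with h | h
        · right
          obtain ⟨u, hu, hb⟩ := hL.bridged j s h
          refine ⟨u, innerTracks_mono (fun s => hL.mono (by omega) s) hu, ?_, hb⟩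
          obtain ⟨s', i, hi, rfl⟩ := hu
          intro e
          have h1 := hL.le j s'
          have h2 := hL.le (j + 1) s
          have h3 := hL.mono (Nat.zero_le j) s
          rw [hL.zero] at h3
          obtain ⟨rfl, rfl⟩ := hR.inj s (a (j + 1) s - 1) s' i (by omega) (by omega) (by omega)
            e.symm
          omega
        · rw [← h]
          exact ih (by omega)
    exact hgen J le_rfl
  · intro z hz
    -- At the first level to which the component of `z` is attached, no leg of the system has
    -- entered it, so a long path inside would complete a fan.
    have hex : ∃ j, z ∈ attached G (onTracks R n)ᶜ (innerTracks R (a j)) := ⟨J, hz⟩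
    obtain ⟨u, hu, x, hux, hxz⟩ := Nat.find_spec hex
    have hjJ : Nat.find hex ≤ J := Nat.find_min' hex hz
    have hmin : ∀ j' < Nat.find hex, ∀ t, ReachIn G (onTracks R n)ᶜ x t →
        t ∉ attached G (onTracks R n)ᶜ (innerTracks R (a j')) := by
      rintro j' hj' t ht ⟨u', hu', x', hx', h'⟩
      exact Nat.find_min hex hj' ⟨u', hu', x', hx', h'.trans (ht.symm.trans hxz)⟩
    refine ⟨x, hxz, fun y D m hD hp => ?_⟩
    obtain ⟨c⟩ := (key _ (hJ _ (by omega))).2 u hu fun j' hj' hu' =>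
      hmin j' hj' x (.refl hxz.mem_left) ⟨u, hu', x, hux, .refl hxz.mem_left⟩
    have hDl : ∀ o, ∀ t ∈ D, t ∉ c.legs o := by
      intro o t ht hto
      obtain ⟨j', hj', h'⟩ := c.earlier o t hto (hD ht)
      exact hmin j' hj' t ((hp.reachIn t ht).mono hD) h'
    have hpath := c.path_none.append hux hp
      (Set.disjoint_left.2 fun t ht htD => hDl none t htD ht)
    by_contra hlt
    exact hF (c.hasFan_of_extension hR (hshort c (by omega)) hpath (by omega) (fun t ht => hD ht)
      hDl)

end Frontier
-- Long paths from treedepth, and the one-track dichotomy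
section Whole

variable {V : Type*} {G : SimpleGraph V}

theorem treedepth_le_treedepth_induce_univ [Finite V] (G : SimpleGraph V) :
    G.treedepth ≤ (G.induce Set.univ).treedepth := by
  obtain ⟨T, hT⟩ := exists_heightLE_treedepth (G.induce Set.univ)
  let e : V → (Set.univ : Set V) := fun v => ⟨v, trivial⟩
  refine Nat.sInf_le ⟨{
    anc := fun u v => T.anc (e u) (e v)
    anc_refl := fun v => T.anc_refl _
    anc_trans := fun u v w => T.anc_trans _ _ _
    anc_antisymm := fun u v h h' => congrArg Subtype.val (T.anc_antisymm _ _ h h')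
    anc_total_of_anc := fun u w v => T.anc_total_of_anc _ _ _
    anc_or_anc_of_adj := fun u v h => T.anc_or_anc_of_adj _ _ h }, fun v => ?_⟩
  refine le_trans (le_of_eq ?_) (hT (e v))
  rw [← Set.ncard_image_of_injective _ Subtype.val_injective]
  congr 1
  ext u
  simp [e]

/-- A connected set of large treedepth contains long paths from each of its vertices. -/
theorem exists_pathTo_of_lt_treedepth [Finite V] {A : Set V} {x : V} {c : ℕ} (hx : x ∈ A)
    (hc : ∀ y ∈ A, ReachIn G A x y) (h : c < (G.induce A).treedepth) :
    ∃ y D m, D ⊆ A ∧ PathTo G x y D m ∧ c ≤ m := by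
  by_contra hcon
  push Not at hcon
  obtain ⟨f, hf, hfc⟩ := exists_isRanking_of_pathTo_lt hx hc hcon
  exact absurd (hf.treedepth_induce_le hfc) (by omega)

/-- The graph `G` without the edges that leave `A`. -/
def restrictTo (G : SimpleGraph V) (A : Set V) : SimpleGraph V where
  Adj u v := G.Adj u v ∧ u ∈ A ∧ v ∈ A
  symm := ⟨fun _ _ h => ⟨h.1.symm, h.2.2, h.2.1⟩⟩
  loopless := ⟨fun _ h => G.loopless.irrefl _ h.1⟩

theorem restrictTo_le (A : Set V) : G.restrictTo A ≤ G := fun _ _ h => h.1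

theorem PathTo.restrictTo {A W : Set V} {w v : V} {l : ℕ} (h : PathTo G w v W l) (hW : W ⊆ A) :
    PathTo (G.restrictTo A) w v W l := by
  induction h with
  | nil => exact .nil
  | @snoc v x W l h ha hx ih =>
    have hW' := (Set.subset_insert x W).trans hW
    exact (ih hW').snoc ⟨ha, hW' h.mem_end, hW (Or.inl rfl)⟩ hx

theorem PathTo.subset_of_restrictTo {A W : Set V} {w v : V} {l : ℕ}
    (h : PathTo (G.restrictTo A) w v W l) (hw : w ∈ A) : W ⊆ A := by
  induction h with
  | nil => simpa using hw
  | snoc _ ha _ ih => exact Set.insert_subset ha.2.2 ih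

theorem ReachIn.restrictTo {A B : Set V} {u v : V} (h : ReachIn G B u v) (hBA : B ⊆ A) :
    ReachIn (G.restrictTo A) B u v := by
  induction h with
  | refl h => exact .refl h
  | tail h ha hx ih => exact ih.tail ⟨ha, hBA h.mem_right, hBA hx⟩ hx

theorem PathTo.isTracks {κ : Type*} {w : V} {v : κ → V} {W : κ → Set V} {l : κ → ℕ} {n : ℕ}
    (hp : ∀ s, PathTo G w (v s) (W s) (l s)) (hl : ∀ s, n ≤ l s)
    (hd : ∀ s s', s ≠ s' → ∀ z ∈ W s, z ∈ W s' → z = w) :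
    ∃ R : κ → ℕ → V, IsTracks G w n R := by
  choose f h0 _ hadj hmem _ hinj using fun s => (hp s).exists_fun
  refine ⟨f, h0, fun s i hi => hadj s i (hi.trans_le (hl s)), ?_⟩
  intro s i s' i' hi hin hin' e
  have h1 := hl s
  have h2 := hl s'
  by_cases hss : s = s'
  · subst hss
    exact ⟨rfl, hinj s i (by omega) i' (by omega) e⟩
  · have := hd s s' hss _ (hmem s i (by omega)) (e ▸ hmem s' i' (by omega))
    rw [← h0 s] at this
    have := hinj s i (by omega) 0 (by omega) this
    omega

/-- A bounded part of the tracks which no bridge leaves, together with all that is attached to it,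
can only be left through the frontier. -/
theorem mem_frontier_of_adj {ι : Type*} {n : ℕ} {R : ι → ℕ → V} {b : ι → ℕ} {u v : V}
    (hclosed : ∀ u ∈ innerTracks R b, ∀ s i, i ≤ n →
      Bridged G (onTracks R n)ᶜ u (R s i) → i ≤ b s)
    (hu : u ∈ innerTracks R b ∪ attached G (onTracks R n)ᶜ (innerTracks R b)) (huv : G.Adj u v)
    (hv : v ∉ innerTracks R b ∪ attached G (onTracks R n)ᶜ (innerTracks R b)) :
    ∃ s, v = R s (b s) := by
  have key : ∀ u' ∈ innerTracks R b, Bridged G (onTracks R n)ᶜ u' v → v ∈ onTracks R n →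
      ∃ s, v = R s (b s) := by
    rintro u' hu' hb ⟨s, i, hi, rfl⟩
    have h1 := hclosed u' hu' s i hi hb
    rcases h1.lt_or_eq with h | h
    · exact absurd (Or.inl ⟨s, i, h, rfl⟩) hv
    · exact ⟨s, by rw [h]⟩
  by_cases hvM : v ∈ onTracks R n
  · rcases hu with hu | ⟨u', hu', x, hx, hxu⟩
    · exact key u hu (Or.inl huv) hvM
    · exact key u' hu' (Or.inr ⟨x, u, hx, hxu, huv⟩) hvM
  · rcases hu with hu | ⟨u', hu', x, hx, hxu⟩
    · exact absurd (Or.inr ⟨u, hu, v, huv, .refl hvM⟩) hv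
    · exact absurd (Or.inr ⟨u', hu', x, hx, hxu.tail huv hvM⟩) hv

theorem attached_subset {A I : Set V} : attached G A I ⊆ A :=
  fun _ ⟨_, _, _, _, h⟩ => h.mem_right

/-- At the start of a long path there are two disjoint long paths, unless a vertex separates the
start from an edge. -/
theorem hasFan_two_or_exists_separator {w v : V} {W : Set V} {l lam : ℕ} (hlam : 1 ≤ lam)
    (hp : PathTo G w v W l) (hl : 2 * (lam - 1) ^ 2 + 4 * lam ≤ l) :
    HasFan G w (Option Unit) lam ∨ ∃ t y y', t ≠ w ∧ y ≠ t ∧ y' ≠ t ∧ G.Adj t y ∧ G.Adj y y' ∧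
      ¬ ReachIn G {t}ᶜ w y := by
  by_contra hcon
  rw [not_or] at hcon
  obtain ⟨hF, hcon⟩ := hcon
  obtain ⟨R, hR⟩ := PathTo.isTracks (κ := Unit) (fun _ => hp) (fun _ => le_rfl)
    (fun s s' h => absurd rfl h)
  obtain ⟨b, hb, hclosed, -, -⟩ := hR.exists_frontier hlam (by simpa using hl) hF
  have hb1 := (hb ()).1
  have hb2 := (hb ()).2
  simp only [Fintype.card_unit] at hb2
  have hne : ∀ i j, 0 < i → i ≤ l → j ≤ l → i ≠ j → R () i ≠ R () j := fun i j hi hil hjl hij e =>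
    hij (hR.inj () i () j hi hil hjl e).2
  -- The frontier of a single track is one vertex; the next two track vertices give the edge beyond
  -- it.
  refine hcon ⟨R () (b ()), R () (b () + 1), R () (b () + 2), ?_, ?_, ?_,
    hR.adj () _ (by omega), hR.adj () _ (by omega), ?_⟩
  · rw [← hR.zero ()]
    exact hne _ _ (by omega) (by omega) (by omega) (by omega)
  · exact hne _ _ (by omega) (by omega) (by omega) (by omega)
  · exact hne _ _ (by omega) (by omega) (by omega) (by omega)
  · intro hr
    have := (hr.of_closed (B := innerTracks R b ∪ attached G (onTracks R l)ᶜ (innerTracks R b))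
      (Or.inl ⟨(), 0, by omega, hR.zero ()⟩) (by
        intro a ha c hc _ hac
        by_contra hcC
        obtain ⟨⟨⟩, h⟩ := mem_frontier_of_adj hclosed ha hac hcC
        exact hc h)).mem_right.2
    rcases this with ⟨⟨⟩, i, hi, e⟩ | h
    · have hi' : i < b () := hi
      exact hne (b () + 1) i (by omega) (by omega) (by omega) (by omega) e.symm
    · exact attached_subset h ⟨(), b () + 1, by omega, rfl⟩

end Whole
-- Graphs split by a cut vertex
section Split

variable {V : Type*} {G : SimpleGraph V}

/-- `u` and `u'` lie in different components of `G - x`, and both components have more than one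
vertex. -/
structure IsSplit (G : SimpleGraph V) (x u u' : V) : Prop where
  left_ne : u ≠ x
  right_ne : u' ≠ x
  not_reachIn : ¬ ReachIn G {x}ᶜ u u'
  left_adj : ∃ y, y ≠ x ∧ G.Adj u y
  right_adj : ∃ y, y ≠ x ∧ G.Adj u' y

theorem IsSplit.symm {x u u' : V} (h : IsSplit G x u u') : IsSplit G x u' u :=
  ⟨h.right_ne, h.left_ne, fun hr => h.not_reachIn hr.symm, h.right_adj, h.left_adj⟩

theorem Connected.exists_adj_reachIn (hc : G.Connected) {x u : V} (hu : u ≠ x) :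
    ∃ a, ReachIn G {x}ᶜ u a ∧ G.Adj x a := by
  obtain ⟨a, b, ha, -, hb, hab⟩ := (hc.reachIn_univ u x).exists_step (B := {x}) hu rfl
  obtain rfl : b = x := hb
  exact ⟨a, ha.mono fun _ h => h.2, hab.symm⟩

variable [Fintype V] [DecidableRel G.Adj]

theorem degree_ne_one_of_adj {x y z : V} (hy : G.Adj x y) (hz : G.Adj x z) (hyz : y ≠ z) :
    G.degree x ≠ 1 := by
  intro h
  rw [← card_neighborFinset_eq_degree, Finset.card_eq_one] at h
  obtain ⟨a, ha⟩ := h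
  have h1 : y ∈ G.neighborFinset x := by simpa using hy
  have h2 : z ∈ G.neighborFinset x := by simpa using hz
  rw [ha, Finset.mem_singleton] at h1 h2
  exact hyz (h1.trans h2.symm)

/-- Without proper bridges, a cut vertex has two neighbours in every component with more than
one vertex. -/
theorem IsSplit.exists_two_adj {x u u' : V} (h : IsSplit G x u u') (hc : G.Connected)
    (hbridge : ∀ u v : V, ¬ G.IsProperBridge u v) :
    ∃ a b, a ≠ b ∧ ReachIn G {x}ᶜ u a ∧ ReachIn G {x}ᶜ u b ∧ G.Adj x a ∧ G.Adj x b := by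
  obtain ⟨a, hua, hxa⟩ := hc.exists_adj_reachIn h.left_ne
  obtain ⟨a', hua', hxa'⟩ := hc.exists_adj_reachIn h.right_ne
  by_contra hcon
  push Not at hcon
  have huniq : ∀ b, ReachIn G {x}ᶜ u b → G.Adj x b → b = a := by
    intro b hub hxb
    by_contra hne
    exact hcon a b (Ne.symm hne) hua hub hxa hxb
  -- With `a` as the only neighbour of `x` in the component, `xa` is a bridge. It is proper: `x`
  -- also has a neighbour on the side of `u'`, and `a` has one inside its component.
  refine hbridge x a ⟨hxa, ?_, ?_, ?_⟩
  · rw [isBridge_iff]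
    intro hr
    obtain ⟨p⟩ := hr.symm
    have hr' : ReachIn (G.deleteEdges {s(x, a)}) Set.univ a x := p.reachIn fun _ _ => trivial
    have := (hr'.of_closed (B := {z | ReachIn G {x}ᶜ u z}) hua (by
      intro c hc d _ _ hcd
      rw [deleteEdges_adj] at hcd
      refine ReachIn.tail hc hcd.1 ?_
      rintro (rfl : d = x)
      have := huniq c hc hcd.1.symm
      subst this
      exact hcd.2 (by simp [Sym2.eq_swap]))).mem_right.2
    exact ReachIn.mem_right this rfl
  · refine degree_ne_one_of_adj hxa hxa' ?_
    rintro rfl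
    exact h.not_reachIn (hua.trans hua'.symm)
  · obtain ⟨y, hyx, hay⟩ : ∃ y, y ≠ x ∧ G.Adj a y := by
      by_cases hne : u = a
      · exact hne ▸ h.left_adj
      · obtain ⟨y, hy, hay⟩ := hua.exists_adj_of_ne hne
        exact ⟨y, hy, hay⟩
    exact degree_ne_one_of_adj hxa.symm hay (Ne.symm hyx)

/-- Without `T`-type subgraphs, the components of `G - x` with more than one vertex have large
treedepth. -/
theorem IsSplit.exists_long_path {x u u' a : V} {c : ℕ} (h : IsSplit G x u u') (hc : G.Connected)
    (hbridge : ∀ u v : V, ¬ G.IsProperBridge u v) (hT : ∀ C : Set V, ¬ G.IsTType c C)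
    (ha : ReachIn G {x}ᶜ u a) :
    ∃ y D m, D ⊆ {z | ReachIn G {x}ᶜ u z} ∧ PathTo G a y D m ∧ c ≤ m := by
  refine exists_pathTo_of_lt_treedepth (A := {z | ReachIn G {x}ᶜ u z}) ha
    (fun y hy => ((ha.symm.trans hy).within_component).mono fun z hz => ha.trans hz) ?_
  by_contra hle
  obtain ⟨b, b', hbb, hub, hub', hxb, hxb'⟩ := h.exists_two_adj hc hbridge
  refine hT {z | ReachIn G {x}ᶜ u z} ⟨⟨a, ha⟩, by omega, {x}, ?_, by simp, ?_, ?_⟩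
  · rintro _ rfl hz
    exact ReachIn.mem_right hz rfl
  · ext z
    constructor
    · rintro ⟨hz, t, ht, hadj⟩
      by_contra hzx
      exact hz (ReachIn.tail ht hadj hzx)
    · rintro rfl
      exact ⟨fun hz => ReachIn.mem_right hz rfl, b, hub, hxb.symm⟩
  · rintro _ rfl
    rw [← Set.ncard_pair hbb]
    refine Set.ncard_le_ncard ?_ (Set.toFinite _)
    rintro z (rfl | rfl)
    · exact ⟨hxb, Or.inl hub⟩
    · exact ⟨hxb', Or.inl hub'⟩

/-- The star exists if some vertex splits the graph. -/
theorem IsSplit.subdividedStar_isContained {k c : ℕ} (hk : 1 ≤ k) (hc : G.Connected)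
    (hbridge : ∀ u v : V, ¬ G.IsProperBridge u v) (hT : ∀ C : Set V, ¬ G.IsTType c C)
    (hck : 2 * (k - 1) ^ 2 + 4 * k ≤ c + 1) (N : ℕ) {x u u' : V} (h : IsSplit G x u u')
    (hN : {z | ReachIn G {x}ᶜ u z}.ncard = N) :
    (subdividedStar ![1, k, k, k]).IsContained G := by
  induction N using Nat.strong_induction_on generalizing x u u' with
  | _ N ih =>
  set K : Set V := {z | ReachIn G {x}ᶜ u z} with hK
  set A : Set V := insert x K with hA
  obtain ⟨a, b, hab, hua, hub, hxa, hxb⟩ := h.exists_two_adj hc hbridge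
  obtain ⟨y, D, m, hD, hp, hm⟩ := h.exists_long_path hc hbridge hT hua
  have hxK : x ∉ K := fun hx => ReachIn.mem_right hx rfl
  -- Legs are sought within `A`, so that the other component stays free for the third leg and the
  -- extra edge.
  have hpA : PathTo (G.restrictTo A) x y ({x} ∪ D) (0 + 1 + m) :=
    (PathTo.nil.append hxa hp (Set.disjoint_singleton_left.2 fun hx => hxK (hD hx))).restrictTo
      (Set.union_subset (by simp [hA]) (hD.trans (Set.subset_insert _ _)))
  rcases hasFan_two_or_exists_separator hk hpA (by omega) with hF | hsep
  · obtain ⟨W, v, l, hW, hl, hd⟩ := hF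
    have hWA : ∀ o, W o ⊆ A := fun o => (hW o).subset_of_restrictTo (Or.inl rfl)
    obtain ⟨a', b', hab', hua', hub', hxa', hxb'⟩ := h.symm.exists_two_adj hc hbridge
    obtain ⟨y', D', m', hD', hp', hm'⟩ := h.symm.exists_long_path hc hbridge hT hua'
    have hKK : ∀ z, ReachIn G {x}ᶜ u' z → z ∉ A := by
      rintro z hz (rfl | hzK)
      · exact hz.mem_right rfl
      · exact h.not_reachIn (ReachIn.trans hzK hz.symm)
    have hleg : PathTo G x y' ({x} ∪ D') (0 + 1 + m') :=
      PathTo.nil.append hxa' hp'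
        (Set.disjoint_singleton_left.2 fun hx => hKK x (hD' hx) (Or.inl rfl))
    have hcross : ∀ o, ∀ z ∈ W o, z ∈ {x} ∪ D' → z = x := by
      rintro o z hz (hz' | hz')
      · exact hz'
      · exact absurd (hWA o hz) (hKK z (hD' hz'))
    -- Only the third leg is shortened, so the first two need just length `k`. One of `a'`, `b'`
    -- differs from the excluded `e`.
    obtain ⟨e, he⟩ := exists_subdividedStar_isContained (G := G) (w := x) hk
      (W := ![W none, W (some ()), {x} ∪ D']) (v := ![v none, v (some ()), y'])
      (l := ![l none, l (some ()), 0 + 1 + m'])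
      (by
        intro i
        fin_cases i
        · exact (hW none).mono_graph (restrictTo_le A)
        · exact (hW (some ())).mono_graph (restrictTo_le A)
        · exact hleg)
      (by
        have h1 := hl none
        have h2 := hl (some ())
        intro i
        fin_cases i
        · exact h1
        · exact h2
        · change k ≤ 0 + 1 + m'
          omega)
      (by
        intro i j hij
        fin_cases i <;> fin_cases j
        · exact absurd rfl hij
        · exact hd _ _ (by simp)
        · exact hcross none
        · exact hd _ _ (by simp)
        · exact absurd rfl hij
        · exact hcross (some ())
        · exact fun z h1 h2 => hcross none z h2 h1
        · exact fun z h1 h2 => hcross (some ()) z h2 h1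
        · exact absurd rfl hij)
      2 (by
        change 2 * k - 1 ≤ 0 + 1 + m'
        omega)
    have hout : ∀ z, ReachIn G {x}ᶜ u' z → ∀ i, i ≠ (2 : Fin 3) →
        z ∉ (![W none, W (some ()), {x} ∪ D'] : Fin 3 → Set V) i := by
      intro z hz i hi hzi
      fin_cases i
      · exact hKK z hz (hWA _ hzi)
      · exact hKK z hz (hWA _ hzi)
      · exact hi rfl
    by_cases hae : a' = e
    · exact he b' hxb' (fun hbe => hab' (hae.trans hbe.symm)) (hout b' hub')
    · exact he a' hxa' hae (hout a' hua')
  · obtain ⟨t, z, z', htx, hzt, hz't, htz, hzz', hnr⟩ := hsep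
    have htK : t ∈ K := htz.2.1.resolve_left htx
    have hzx : z ≠ x := by
      rintro rfl
      exact hnr (.refl (Ne.symm htx))
    have hzK : z ∈ K := htz.2.2.resolve_left hzx
    have hstay : ∀ q, ReachIn G ({t}ᶜ \ {x}) z q → q ∈ K := by
      intro q hq
      exact ReachIn.trans hzK (hq.mono fun _ h => h.2)
    -- Until it enters `x`, a walk from `z` avoiding `t` stays in `K`, so the separation found
    -- inside `A` holds in `G`.
    have hnr' : ¬ ReachIn G {t}ᶜ z x := by
      intro hr
      obtain ⟨p, q, hzp, -, hq, hpq⟩ := hr.exists_step (B := {x}) hzx rfl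
      obtain rfl : q = x := hq
      refine hnr (ReachIn.symm ?_)
      have h1 : ReachIn (G.restrictTo A) {t}ᶜ z p :=
        ((hzp.within_component).restrictTo fun s hs => Or.inr (hstay s hs)).mono
          fun s hs => (ReachIn.mem_right hs).1
      exact h1.tail ⟨hpq, Or.inr (hstay p hzp), Or.inl rfl⟩ (Ne.symm htx)
    have hsub : {q | ReachIn G {t}ᶜ z q} ⊂ K := by
      refine Set.ssubset_iff_subset_ne.2 ⟨?_, ?_⟩
      · intro q hq
        refine (ReachIn.of_closed hq hzK ?_).mem_right.2
        intro c hcK d _ hzd hcd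
        exact ReachIn.tail hcK hcd fun hdx => hnr' (hdx ▸ hzd)
      · intro e
        have : t ∈ {q | ReachIn G {t}ᶜ z q} := e ▸ htK
        exact ReachIn.mem_right this rfl
    refine ih _ ?_ (x := t) (u := z) (u' := x) ⟨hzt, Ne.symm htx, hnr', ⟨z', hz't, hzz'.1⟩, ?_⟩ rfl
    · rw [← hN]
      exact Set.ncard_lt_ncard hsub (Set.toFinite _)
    · by_cases hat : a = t
      · exact ⟨b, fun hbt => hab (hat.trans hbt.symm), hxb⟩
      · exact ⟨a, hat, hxa⟩

end Split
-- `T`-type subgraphs from two tracks, and the case without splits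
section TType

variable {V : Type*} {G : SimpleGraph V} {w : V} {n : ℕ}

theorem two_le_ncard_of_mem [Finite V] {A : Set V} {x y : V} (hx : x ∈ A) (hy : y ∈ A)
    (hxy : x ≠ y) : 2 ≤ A.ncard := by
  rw [← Set.ncard_pair hxy]
  exact Set.ncard_le_ncard (Set.insert_subset hx (Set.singleton_subset_iff.2 hy)) (Set.toFinite _)

theorem ncard_pair_le (x y : V) : ({x, y} : Set V).ncard ≤ 2 := by
  have := Set.ncard_insert_le x {y}
  rwa [Set.ncard_singleton] at this

theorem exists_ne_of_two_le_ncard [Finite V] {A : Set V} (h : 2 ≤ A.ncard) (w : V) :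
    ∃ z ∈ A, z ≠ w := by
  by_contra hcon
  push Not at hcon
  have : A.ncard ≤ ({w} : Set V).ncard :=
    Set.ncard_le_ncard (fun z hz => hcon z hz) (Set.toFinite _)
  rw [Set.ncard_singleton] at this
  omega

/-- The treedepth of a part of two tracks together with the attached components. -/
theorem treedepth_induce_le_of_innerTracks [Finite V] {R : Fin 2 → ℕ → V} {b : Fin 2 → ℕ}
    {lam : ℕ} {M C : Set V}
    (hroot : ∀ z ∈ attached G Mᶜ (innerTracks R b), ∃ x, ReachIn G Mᶜ x z ∧
        ∀ y D m, D ⊆ Mᶜ → PathTo G x y D m → m + 1 < lam)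
    (hC : C ⊆ innerTracks R b ∪ attached G Mᶜ (innerTracks R b)) :
    (G.induce C).treedepth ≤ lam - 1 + (b 0 + b 1) := by
  set I := innerTracks R b
  obtain ⟨f, hf, hfd⟩ : ∃ f, IsRanking G (attached G Mᶜ I) f ∧
      ∀ z ∈ attached G Mᶜ I, f z < lam - 1 := by
    refine exists_isRanking_of_components fun z hz => ?_
    obtain ⟨x, hxz, hx⟩ := hroot z hz
    obtain ⟨f, hf, hfd⟩ := exists_isRanking_of_pathTo_lt (G := G) (d := lam - 1)
      (A := {y | ReachIn G Mᶜ x y}) (x := x) (.refl hxz.mem_left)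
      (fun y hy => ReachIn.within_component hy)
      (fun y D m hD hp => by
        have := hx y D m (fun t ht => (hD ht).mem_right) hp
        omega)
    have hsub : {y | ReachIn G (attached G Mᶜ I) z y} ⊆ {y | ReachIn G Mᶜ x y} :=
      fun y hy => hxz.trans (ReachIn.mono hy attached_subset)
    exact ⟨f, hf.mono hsub, fun y hy => hfd y (hsub hy)⟩
  have hsub : (I ∪ attached G Mᶜ I) \ I ⊆ attached G Mᶜ I := by
    rintro z ⟨hz | hz, hzI⟩
    · exact absurd hz hzI
    · exact hz
  obtain ⟨g, hg, hgd⟩ := exists_isRanking_of_diff (A := I ∪ attached G Mᶜ I) (I := I)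
    (Set.toFinite _) (hf.mono hsub) (fun z hz => hfd z (hsub hz))
  have hI : I.ncard ≤ b 0 + b 1 := by
    have h1 : I ⊆ R 0 '' Set.Iio (b 0) ∪ R 1 '' Set.Iio (b 1) := by
      rintro _ ⟨s, i, hi, rfl⟩
      fin_cases s
      · exact Or.inl ⟨i, hi, rfl⟩
      · exact Or.inr ⟨i, hi, rfl⟩
    have h2 : ∀ s, (R s '' Set.Iio (b s)).ncard ≤ b s := fun s => by
      have := Set.ncard_image_le (f := R s) (Set.finite_Iio (b s))
      simpa using this
    calc I.ncard ≤ _ := Set.ncard_le_ncard h1 (Set.toFinite _)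
      _ ≤ _ := Set.ncard_union_le _ _
      _ ≤ _ := Nat.add_le_add (h2 0) (h2 1)
  exact (hg.mono hC).treedepth_induce_le fun z hz => (hgd z (hC hz)).trans_le (by omega)

/-- The part of two tracks before a frontier yields a `T`-type subgraph. -/
theorem exists_isTType_of_frontier [Fintype V] [DecidableRel G.Adj] {R : Fin 2 → ℕ → V}
    {b : Fin 2 → ℕ} {lam c : ℕ} (hR : IsTracks G w n R) (hb : ∀ s, 1 ≤ b s ∧ b s ≤ n)
    (hdeg : 4 ≤ G.degree w)
    (hclosed : ∀ u ∈ innerTracks R b, ∀ s i, i ≤ n →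
      Bridged G (onTracks R n)ᶜ u (R s i) → i ≤ b s)
    (hfront : ∀ s, b s = 1 ∨ ∃ u ∈ innerTracks R b, u ≠ R s (b s - 1) ∧
      Bridged G (onTracks R n)ᶜ u (R s (b s)))
    (hroot : ∀ z ∈ attached G (onTracks R n)ᶜ (innerTracks R b),
      ∃ x, ReachIn G (onTracks R n)ᶜ x z ∧
        ∀ y D m, D ⊆ (onTracks R n)ᶜ → PathTo G x y D m → m + 1 < lam)
    (hc : lam - 1 + (b 0 + b 1) ≤ c) : ∃ C, G.IsTType c C := by
  classical
  set I := innerTracks R b with hI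
  set M := onTracks R n with hM
  set C' := I ∪ attached G Mᶜ I with hC'
  have hIM : I ⊆ M := by
    rintro _ ⟨s, i, hi, rfl⟩
    exact ⟨s, i, by have := hb s; omega, rfl⟩
  have htd : ∀ C ⊆ C', (G.induce C).treedepth ≤ c := fun C hC =>
    (treedepth_induce_le_of_innerTracks hroot hC).trans hc
  have hfr : ∀ u ∈ C', ∀ v, G.Adj u v → v ∉ C' → ∃ s, v = R s (b s) := fun u hu v huv hv =>
    mem_frontier_of_adj hclosed hu huv hv
  have hwI : w ∈ I := ⟨0, 0, (hb 0).1, hR.zero 0⟩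
  have hvC : ∀ s, R s (b s) ∉ C' := by
    rintro s (⟨s', i, hi, e⟩ | h)
    · obtain ⟨rfl, rfl⟩ := hR.inj s (b s) s' i (hb s).1 (hb s).2
        (by have := hb s'; omega) e.symm
      omega
    · exact attached_subset h ⟨s, b s, (hb s).2, rfl⟩
  have hvw : ∀ s, R s (b s) ≠ w := fun s e => hvC s (e ▸ Or.inl hwI)
  have hprevI : ∀ s, R s (b s - 1) ∈ I := fun s =>
    ⟨s, b s - 1, by have := (hb s).1; omega, rfl⟩
  have hprev : ∀ s, G.Adj (R s (b s)) (R s (b s - 1)) := by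
    intro s
    have h1 := hb s
    have := (hR.adj s (b s - 1) (by omega)).symm
    rwa [Nat.sub_add_cancel h1.1] at this
  set S : Set V := Set.range fun s => R s (b s) with hS
  have hnbr : ∀ u ∈ C', ∀ v, G.Adj u v → v ∈ C' ∪ S := by
    intro u hu v huv
    by_cases hv : v ∈ C'
    · exact Or.inl hv
    · obtain ⟨s, rfl⟩ := hfr u hu v huv hv
      exact Or.inr ⟨s, rfl⟩
  let good : Fin 2 → Prop := fun s => 2 ≤ (G.neighborSet (R s (b s)) ∩ (C' ∪ S)).ncard
  -- A bad frontier vertex sees only its track predecessor. A bridge as in `hfront` would supply a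
  -- second neighbour (its source or its last interior vertex), so `b s = 1` and the predecessor is
  -- `w`.
  have hbad : ∀ s, ¬ good s → ∀ z ∈ G.neighborSet (R s (b s)) ∩ (C' ∪ S), z = w := by
    intro s hs z hz
    have hprevmem : R s (b s - 1) ∈ G.neighborSet (R s (b s)) ∩ (C' ∪ S) :=
      ⟨hprev s, Or.inl (Or.inl (hprevI s))⟩
    have honly : ∀ z ∈ G.neighborSet (R s (b s)) ∩ (C' ∪ S), z = R s (b s - 1) := by
      intro z hz
      by_contra hne
      exact hs (two_le_ncard_of_mem hz hprevmem hne)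
    rcases hfront s with h1 | ⟨u, hu, hne, h⟩
    · rw [honly z hz, h1]
      exact hR.zero s
    · exfalso
      rcases h with h | ⟨x, y, hux, hxy, hyv⟩
      · exact hne (honly u ⟨h.symm, Or.inl (Or.inl hu)⟩)
      · have := honly y ⟨hyv.symm, Or.inl (Or.inr ⟨u, hu, x, hux, hxy⟩)⟩
        exact hxy.mem_right (this ▸ hIM (hprevI s))
  by_cases hall : ∀ s, good s
  · refine ⟨C', ⟨w, Or.inl hwI⟩, htd C' subset_rfl, S, ?_, ?_, ?_, ?_⟩
    · rintro _ ⟨s, rfl⟩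
      exact hvC s
    · have : S = {R 0 (b 0), R 1 (b 1)} := by
        ext z
        simp [hS, Fin.exists_fin_two, eq_comm]
      rw [this]
      exact ncard_pair_le _ _
    · ext z
      constructor
      · rintro ⟨hz, u, hu, huz⟩
        obtain ⟨s, rfl⟩ := hfr u hu z huz hz
        exact ⟨s, rfl⟩
      · rintro ⟨s, rfl⟩
        exact ⟨hvC s, _, Or.inl (hprevI s), (hprev s).symm⟩
    · rintro _ ⟨s, rfl⟩
      exact hall s
  · push Not at hall
    obtain ⟨s₀, hs₀⟩ := hall
    obtain ⟨s₁, hs₁⟩ : ∃ s₁, ∀ s : Fin 2, s = s₀ ∨ s = s₁ := by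
      fin_cases s₀
      · exact ⟨1, by simp [Fin.forall_fin_two]⟩
      · exact ⟨0, by simp [Fin.forall_fin_two]⟩
    -- Since bad frontier vertices see only `w`, moving `w` into the witness set cuts them off, and
    -- `w` replaces at least one of them. Of the four neighbours of `w` at most two are frontier
    -- vertices.
    set S' : Set V := insert w {z | ∃ s, good s ∧ z = R s (b s)} with hS'
    have hS'sub : S' ⊆ {w, R s₁ (b s₁)} := by
      rintro z (rfl | ⟨s, hs, rfl⟩)
      · exact Or.inl rfl
      · rcases hs₁ s with rfl | rfl
        · exact absurd hs hs₀
        · exact Or.inr rfl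
    have hcover : ∀ z ∈ C' ∪ S, (∀ s, ¬ good s → z ≠ R s (b s)) → z ∈ C' \ {w} ∪ S' := by
      rintro z (hz | ⟨s, rfl⟩) hne
      · by_cases hzw : z = w
        · exact Or.inr (Or.inl hzw)
        · exact Or.inl ⟨hz, hzw⟩
      · by_cases hs : good s
        · exact Or.inr (Or.inr ⟨s, hs, rfl⟩)
        · exact absurd rfl (hne s hs)
    have hw2 : 2 ≤ (G.neighborSet w ∩ (C' \ {w} ∪ S')).ncard := by
      have hsub : G.neighborSet w ⊆ (G.neighborSet w ∩ (C' \ {w} ∪ S')) ∪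
          {R s₀ (b s₀), R s₁ (b s₁)} := by
        intro z hz
        by_cases hzp : z ∈ ({R s₀ (b s₀), R s₁ (b s₁)} : Set V)
        · exact Or.inr hzp
        · refine Or.inl ⟨hz, hcover z (hnbr w (Or.inl hwI) z hz) fun s _ e => hzp ?_⟩
          rcases hs₁ s with rfl | rfl
          · exact Or.inl e
          · exact Or.inr e
      have h1 := Set.ncard_le_ncard hsub (Set.toFinite _)
      have h2 := Set.ncard_union_le (G.neighborSet w ∩ (C' \ {w} ∪ S'))
        {R s₀ (b s₀), R s₁ (b s₁)}
      have h3 := ncard_pair_le (R s₀ (b s₀)) (R s₁ (b s₁))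
      have h4 : (G.neighborSet w).ncard = G.degree w := by
        rw [← card_neighborSet_eq_degree, ← Nat.card_eq_fintype_card, Nat.card_coe_set_eq]
      omega
    have hg2 : ∀ s, good s →
        2 ≤ (G.neighborSet (R s (b s)) ∩ (C' \ {w} ∪ S')).ncard := by
      intro s hs
      refine le_trans hs (Set.ncard_le_ncard ?_ (Set.toFinite _))
      rintro z ⟨hz, hzC⟩
      refine ⟨hz, hcover z hzC ?_⟩
      rintro s' hs' rfl
      exact hvw s (hbad s' hs' _ ⟨G.adj_symm hz, Or.inr ⟨s, rfl⟩⟩)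
    have hw3 : ∃ u ∈ C' \ {w}, G.Adj w u := by
      obtain ⟨z, ⟨hz, hzC | hzS⟩, hzv⟩ := exists_ne_of_two_le_ncard hw2 (R s₁ (b s₁))
      · exact ⟨z, hzC, hz⟩
      · rcases hS'sub hzS with rfl | rfl
        · exact absurd hz (G.loopless.irrefl _)
        · exact absurd rfl hzv
    obtain ⟨u₀, hu₀, hwu₀⟩ := hw3
    refine ⟨C' \ {w}, ⟨u₀, hu₀⟩, htd _ Set.sdiff_subset, S', ?_, ?_, ?_, ?_⟩
    · rintro z (rfl | ⟨s, -, rfl⟩)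
      · exact fun h => h.2 rfl
      · exact fun h => hvC s h.1
    · exact (Set.ncard_le_ncard hS'sub (Set.toFinite _)).trans (ncard_pair_le _ _)
    · ext z
      constructor
      · rintro ⟨hz, u, ⟨hu, huw⟩, huz⟩
        refine (hcover z (hnbr u hu z huz) ?_).resolve_left hz
        rintro s hs rfl
        exact huw (hbad s hs u ⟨huz.symm, Or.inl hu⟩)
      · rintro (rfl | ⟨s, hs, rfl⟩)
        · exact ⟨fun h => h.2 rfl, u₀, hu₀, hwu₀.symm⟩
        · refine ⟨fun h => hvC s h.1, ?_⟩
          obtain ⟨z, ⟨hz, hzC | hzS⟩, hzw⟩ := exists_ne_of_two_le_ncard (hg2 s hs) w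
          · exact ⟨z, hzC, G.adj_symm hz⟩
          · have h1 := hS'sub hzS
            rcases hs₁ s with rfl | rfl
            · exact absurd hs hs₀
            · rcases h1 with rfl | rfl
              · exact absurd rfl hzw
              · exact absurd hz (G.loopless.irrefl _)
    · rintro z (rfl | ⟨s, hs, rfl⟩)
      · exact hw2
      · exact hg2 s hs

theorem subdividedStar_one_isContained [Fintype V] [DecidableRel G.Adj] (hdeg : 4 ≤ G.degree w) :
    (subdividedStar ![1, 1, 1, 1]).IsContained G := by
  obtain ⟨s, hs, hcard⟩ := Finset.exists_subset_card_eq hdeg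
  let e := s.equivFinOfCardEq hcard
  have ha : ∀ i, (![1, 1, 1, 1] : Fin 4 → ℕ) i = 1 := by
    intro i; fin_cases i <;> rfl
  have hadj : ∀ i, G.Adj w (e.symm i) := fun i => by simpa using hs (e.symm i).2
  refine subdividedStar_isContained_of_fun (w := w) _ (fun i _ => (e.symm i : V)) ?_ ?_ ?_ ?_
  · exact fun i _ => hadj i
  · intro i j hj
    rw [ha] at hj
    omega
  · exact fun i j _ => (hadj i).ne'
  · intro i j i' j' hj hj' h
    rw [ha] at hj hj'
    exact ⟨e.symm.injective (Subtype.ext h), by omega⟩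

/-- The star exists if no vertex splits the graph and the treedepth is large. -/
theorem subdividedStar_isContained_of_not_isSplit [Fintype V] [DecidableRel G.Adj] {k c : ℕ}
    (hk : 1 ≤ k) (hconn : G.Connected) (hsplit : ∀ x u u', ¬ IsSplit G x u u')
    (hdeg : 4 ≤ G.degree w) (hn : n = 3 * (2 * k - 1 - 1) ^ 2 + 4 * (2 * k - 1))
    (htd : 2 * (n - 1) ^ 2 + 4 * n < G.treedepth) (hT : ∀ C : Set V, ¬ G.IsTType c C)
    (hc : 2 * k - 1 - 1 + 2 * (3 * (2 * k - 1 - 1) ^ 2 + 1) ≤ c) :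
    (subdividedStar ![1, k, k, k]).IsContained G := by
  by_contra hstar
  have hfan : ¬ HasFan G w (Option (Fin 2)) (2 * k - 1) := fun h =>
    hstar ((h.reindex (finSuccEquiv 2).toEmbedding).subdividedStar_isContained hk hdeg)
  obtain ⟨y, D, m, -, hp, hm⟩ := exists_pathTo_of_lt_treedepth (G := G) (A := Set.univ) (x := w)
    trivial (fun y _ => hconn.reachIn_univ w y)
    (htd.trans_le (treedepth_le_treedepth_induce_univ G))
  -- Here the required leg length is `n`, so that the two legs can serve as tracks for the next
  -- dichotomy, with leg length `2k-1`.
  rcases hasFan_two_or_exists_separator (by omega) hp hm with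
    ⟨W, v, l, hW, hl, hd⟩ | ⟨t, y, y', htw, hyt, hy't, -, hyy', hnr⟩
  · let e : Fin 2 ≃ Option Unit := (finSuccEquiv 1).trans (Equiv.optionCongr (Equiv.equivPUnit _))
    obtain ⟨R, hR⟩ := PathTo.isTracks (n := n) (fun s => hW (e s)) (fun s => hl (e s))
      fun s s' h => hd _ _ (e.injective.ne h)
    obtain ⟨b, hb, hclosed, hfront, hroot⟩ := hR.exists_frontier (by omega)
      (by rw [Fintype.card_fin]; omega) hfan
    rw [Fintype.card_fin] at hb
    have h0 := (hb 0).2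
    have h1 := (hb 1).2
    obtain ⟨C, hC⟩ := exists_isTType_of_frontier hR
      (fun s => ⟨(hb s).1, (hb s).2.trans (by omega)⟩) hdeg hclosed hfront hroot
      (le_trans (by omega) hc)
    exact hT C hC
  · have hwt : ∃ z, z ≠ t ∧ G.Adj w z := by
      have h4 : (G.neighborSet w).ncard = G.degree w := by
        rw [← card_neighborSet_eq_degree, ← Nat.card_eq_fintype_card, Nat.card_coe_set_eq]
      obtain ⟨z, hz, hzt⟩ := exists_ne_of_two_le_ncard (A := G.neighborSet w) (by omega) t
      exact ⟨z, hzt, hz⟩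
    exact hsplit t w y ⟨Ne.symm htw, hyt, hnr, hwt, ⟨y', hy't, hyy'⟩⟩

end TType
end SimpleGraph

/-! ### Assembly and numerical bounds -/

open SimpleGraph in
theorem mainTheorem3 {V : Type*} [Fintype V] (G : SimpleGraph V) [DecidableRel G.Adj]
    (k : ℕ) (hk : 1 ≤ k) (hconn : G.Connected)
    (hbridge : ∀ u v : V, ¬ G.IsProperBridge u v)
    (hdeg : ∃ v : V, 4 ≤ G.degree v)
    (htd : 8 * (7 * (k : ℝ) ^ 3 + 15 * (k : ℝ) ^ 2 - 4 * (k : ℝ) / 9 + 3) ^ 2 + 6 ≤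
      (G.treedepth : ℝ))
    (hT : ∀ C : Set V, ¬ G.IsTType (16 * (2 * k - 1) * (k - 1)) C) :
    (SimpleGraph.subdividedStar ![1, k, k, k]).IsContained G := by
  obtain ⟨w, hw⟩ := hdeg
  obtain rfl | ⟨κ, rfl⟩ : k = 1 ∨ ∃ κ, k = κ + 2 := by
    rcases Nat.lt_or_ge k 2 with h | h
    · exact Or.inl (by omega)
    · exact Or.inr ⟨k - 2, by omega⟩
  -- For `k = 1` the treedepth bound is `0` and `hT` is empty, but four neighbours already form the
  -- star.
  · exact subdividedStar_one_isContained hw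
  have e1 : 2 * (κ + 2) - 1 = 2 * κ + 3 := by omega
  have e2 : κ + 2 - 1 = κ + 1 := by omega
  have e3 : 2 * κ + 3 - 1 = 2 * κ + 2 := by omega
  by_cases hsplit : ∃ x u u', IsSplit G x u u'
  · obtain ⟨x, u, u', h⟩ := hsplit
    refine h.subdividedStar_isContained hk hconn hbridge hT ?_ _ rfl
    rw [e1, e2]
    nlinarith
  · push Not at hsplit
    refine subdividedStar_isContained_of_not_isSplit (w := w) hk hconn hsplit hw rfl ?_ hT ?_
    · rw [e1, e3]
      have e4 : 3 * (2 * κ + 2) ^ 2 + 4 * (2 * κ + 3) - 1 = 12 * κ ^ 2 + 32 * κ + 23 := by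
        rw [Nat.sub_eq_iff_eq_add (by omega)]
        ring
      -- With `n = 12κ² + 32κ + 24`, the need is `2(n-1)² + 4n = 2n² + 2`, which is below `8n² + 6`.
      -- It remains to compare `n` with the cubic in `htd`.
      rw [e4, ← Nat.cast_lt (α := ℝ)]
      refine lt_of_lt_of_le ?_ htd
      push_cast
      have hκ : (0 : ℝ) ≤ κ := Nat.cast_nonneg κ
      have h1 : 12 * (κ : ℝ) ^ 2 + 32 * κ + 24 ≤ 7 * ((κ : ℝ) + 2) ^ 3 + 15 * ((κ : ℝ) + 2) ^ 2 -
          4 * ((κ : ℝ) + 2) / 9 + 3 := by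
        nlinarith [pow_nonneg hκ 3, pow_nonneg hκ 2]
      have h2 := pow_le_pow_left₀ (by positivity) h1 2
      nlinarith [sq_nonneg (12 * (κ : ℝ) ^ 2 + 32 * κ + 24)]
    · rw [e1, e2, e3]
      nlinarith
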